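/- Theorem 1. Put $G_\sigma(z)=e^{-z^2/(2\sigma^2)}$. For $\Delta,\kappa>0$ and $\mu\in\mathbb R$ let $$\psi_\mu^{(\Delta,\kappa)}(x)=N_\mu\sum_{s\in\mathbb Z}G_{1/\kappa}\big((2s+\mu)\sqrt\pi\big)\,G_\Delta\big(x-(2s+\mu)\sqrt\pi\big)$$ be the finite-energy GKP wavefunction, with $N_\mu>0$ chosen so that it is $L^2$-normalized. Let $\psi_+\propto\psi_0+\psi_1$ (normalized), and for $(a_0,a_1)\in\mathbb C^2\setminus\{0\}$ let $Q_\alpha^{(\Delta,\kappa)}=a_0\psi_\alpha^{(\Delta,\kappa)}+a_1\psi_{1+\alpha}^{(\Delta,\kappa)}$. Let $s(x)=\frac12\,\mathrm{rem}\big(\lfloor x/\sqrt{\pi/2}\rceil,4\big)\in\{0,\frac12,1,\frac32\}$, where $\lfloor\cdot\rceil$ is rounding to the nearest integer and $\mathrm{rem}(n,4)$ is the remainder of $n$ modulo $4$. The q-SE circuit acts on the two-mode wavefunction $f(x)\,\psi_+^{(\Delta,\kappa)}(y)$ by a 50:50 beam splitter, $\Phi(x,y)\mapsto\Phi\big(\tfrac{x+y}{\sqrt2},\tfrac{-x+y}{\sqrt2}\big)$,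 followed by a squeezer on the first mode, $\Phi(x,y)\mapsto 2^{1/4}\Phi(\sqrt2\,x,y)$; then the position $y$ of the second mode is measured, with result $x_{\mathrm m}$. For the input $f(x)=Q_\alpha^{(\Delta,\kappa)}(x-u)$, the state of the first mode after the result $x_{\mathrm m}$ is approximately $$Q_{\alpha/2-s(x_{\mathrm m}-\alpha\sqrt{\pi/2})}^{(\Delta/\sqrt2,\;\kappa\sqrt2)}\big(x-\tfrac u2\big)$$ (for $\alpha=0$: $Q_{-s(x_{\mathrm m})}^{(\Delta/\sqrt2,\kappa\sqrt2)}(x-\frac u2)$), in the following sense. Let $F(x_{\mathrm m})$ be the fidelity $|\langle f,g\rangle|^2/(\|f\|^2\|g\|^2)$ between the state after the measurement and this predicted state. (i) For all $\varepsilon,\delta,R>0$ there is $\eta>0$ such that for all $\Delta,\kappa\in(0,\eta)$, all $(a_0,a_1)\neq0$ and all real $\alpha,u,x_{\mathrm m}$: if $t=(x_{\mathrm m}-\alpha\sqrt{\pi/2}-u/\sqrt2)/\sqrt{\pi/2}$ satisfies $|t-\lfloor t\rceil|\le\frac12-\delta$ (no tie in the rounding), $|x_{\mathrm m}-u/\sqrt2|\le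 R/\kappa$, and $s(x_{\mathrm m}-\alpha\sqrt{\pi/2}-u/\sqrt2)=s(x_{\mathrm m}-\alpha\sqrt{\pi/2})$ (no tracking error), then $F(x_{\mathrm m})\ge1-\varepsilon$. (ii) For every $\varepsilon>0$ and $r<\sqrt\pi/2$ there is $\eta>0$ such that for all $\Delta,\kappa\in(0,\eta)$, all $(a_0,a_1)\ne0$, all $\alpha\in\mathbb R$ and all $|u|\le r$, the average of $F(x_{\mathrm m})$ over the probability distribution of the measurement result $x_{\mathrm m}$ is at least $1-\varepsilon$. -/

import Mathlib

noncomputable section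

namespace GKP

/-! Wavefunctions are functions of the q-quadrature, with `ħ = 1`: `ℝ → ℂ` for one mode and
`ℝ → ℝ → ℂ` for two modes (top mode first, auxiliary bottom mode second). -/

/-- The Gaussian function `G_σ(z) = exp (-z² / (2σ²))`. -/
def gauss (σ z : ℝ) : ℝ := Real.exp (-z ^ 2 / (2 * σ ^ 2))

/-- The unnormalized finite-energy GKP comb of widths `(Δ, κ)` with peaks at `(2s + μ)√π`,
`s ∈ ℤ`; the peak shift `μ` may be any real number. -/
def comb (Δ κ μ x : ℝ) : ℝ :=
  ∑' s : ℤ, gauss (1 / κ) ((2 * (s : ℝ) + μ) * √Real.pi) *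
    gauss Δ (x - (2 * (s : ℝ) + μ) * √Real.pi)

/-- The normalization constant `N_μ` of the comb. -/
def combNorm (Δ κ μ : ℝ) : ℝ := (√(∫ x : ℝ, comb Δ κ μ x ^ 2))⁻¹

/-- The normalized GKP wavefunction `ψ_μ^{(Δ, κ)}`. -/
def psi (Δ κ μ x : ℝ) : ℝ := combNorm Δ κ μ * comb Δ κ μ x

/-- The auxiliary GKP wavefunction `ψ_+ ∝ ψ_0 + ψ_1`, normalized. -/
def psiPlus (Δ κ x : ℝ) : ℝ :=
  (√(∫ t : ℝ, (psi Δ κ 0 t + psi Δ κ 1 t) ^ 2))⁻¹ * (psi Δ κ 0 x + psi Δ κ 1 x)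

/-- The qubit wavefunction `Q_α^{(Δ, κ)} = a₀ ψ_α^{(Δ, κ)} + a₁ ψ_{1+α}^{(Δ, κ)}`. -/
def qubit (a₀ a₁ : ℂ) (Δ κ α x : ℝ) : ℂ :=
  a₀ * (psi Δ κ α x : ℂ) + a₁ * (psi Δ κ (1 + α) x : ℂ)

/-- The step function `s(x) = rem (⌊x / √(π/2)⌉, 4) / 2`, with values in `{0, 1/2, 1, 3/2}`. -/
def step (x : ℝ) : ℝ := ((round (x / √(Real.pi / 2)) % 4 : ℤ) : ℝ) / 2

/-- The beam splitter `exp (-(φ/2) (a†b - ab†)) = exp (-(φ/2) (x ∂_y - y ∂_x))`: the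
anticlockwise rotation of a two-mode wavefunction by the angle `φ/2`. -/
def beamSplitter (φ : ℝ) (Φ : ℝ → ℝ → ℂ) : ℝ → ℝ → ℂ := fun x y =>
  Φ (x * Real.cos (φ / 2) + y * Real.sin (φ / 2)) (-x * Real.sin (φ / 2) + y * Real.cos (φ / 2))

/-- The squeezer `exp ((ln c / 2) (a² - a†²)) = exp (ln c (x ∂_x + 1/2))` on the top mode. -/
def squeezeTop (c : ℝ) (Φ : ℝ → ℝ → ℂ) : ℝ → ℝ → ℂ := fun x y =>
  ((√c : ℝ) : ℂ) * Φ (c * x) y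

/-- The two-mode wavefunction in the q-SE circuit just before the measurement, for the input `f`
in the top mode and `ψ_+^{(Δ, κ)}` in the bottom mode: first the 50:50 beam splitter, then the
squeezer by `√2` on the top mode. -/
def qSE (Δ κ : ℝ) (f : ℝ → ℂ) : ℝ → ℝ → ℂ :=
  squeezeTop (√2) (beamSplitter (Real.pi / 2) fun x y => f x * (psiPlus Δ κ y : ℂ))

/-- The probability density of the result `xm` of the q-quadrature measurement of the bottom
mode. -/
def outcomeDensity (Δ κ : ℝ) (f : ℝ → ℂ) (xm : ℝ) : ℝ :=
  (∫ x : ℝ, ‖qSE Δ κ f x xm‖ ^ 2) / ∫ y : ℝ, ∫ x : ℝ, ‖qSE Δ κ f x y‖ ^ 2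

/-- The normalized wavefunction of the top mode after the measurement result `xm`. -/
def qSEOutput (Δ κ : ℝ) (f : ℝ → ℂ) (xm : ℝ) : ℝ → ℂ := fun x =>
  (((√(∫ t : ℝ, ‖qSE Δ κ f t xm‖ ^ 2))⁻¹ : ℝ) : ℂ) * qSE Δ κ f x xm

/-- The fidelity `|⟨f, g⟩|² / (‖f‖² ‖g‖²)` of the pure states given by the wavefunctions
`f` and `g`. -/
def fidelity (f g : ℝ → ℂ) : ℝ :=
  ‖∫ x : ℝ, (starRingEnd ℂ) (f x) * g x‖ ^ 2 / ((∫ x : ℝ, ‖f x‖ ^ 2) * ∫ x : ℝ, ‖g x‖ ^ 2)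

/-- The fidelity between the state that the q-SE circuit outputs, with the measurement result `xm`,
on the shifted qubit `Q_α^{(Δ, κ)}(x - u)`, and its predicted value
`Q_{α/2 - s}^{(Δ/√2, κ√2)}(x - u/2)` with `s = s(xm - α√(π/2))`. -/
def qSEFidelity (a₀ a₁ : ℂ) (Δ κ α u xm : ℝ) : ℝ :=
  fidelity (qSEOutput Δ κ (fun x => qubit a₀ a₁ Δ κ α (x - u)) xm)
    (fun x => qubit a₀ a₁ (Δ / √2) (κ * √2)
      (α / 2 - step (xm - α * √(Real.pi / 2))) (x - u / 2))

end GKP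

end

open MeasureTheory Filter Topology
namespace GKP

/-! For a fixed result `xm` the circuit output is, up to a constant, the product of
$Q_\alpha(x+x_m/\sqrt2-u)$ and $(\psi_0+\psi_1)(-x+x_m/\sqrt2)$ (`qSE_eq`, `rawOutput`). Both
factors are sums of Gaussians, with indices $n$ and $m$. A product of two Gaussians of width
$\Delta$ is a Gaussian of width $\Delta/\sqrt2$ at the midpoint of the centers, damped by their
distance. Here the midpoint depends only on $n-m$ and the distance only on $n+m$. The envelopes
separate in the same way, since $(n+\alpha)^2+m^2=\frac12\big((n+m+\alpha)^2+(n-m+\alpha)^2\big)$.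
So the output is a superposition over $k=n+m$ with weights `peakWeight`, concentrated near the
rescaled result $t$ (`rawOutput_eq_tsum`).

In the part $k=k_0$, $n-m=2n-k_0$: the peaks have spacing $\sqrt\pi$ and amplitudes given by the
parity of $n$. This is the predicted qubit with shift $(\alpha-k_0)/2$. Changing $k_0$ by 4 shifts
$n$ by 2 and keeps parities, hence the remainder modulo 4 (`tsum_pairTerm_split`,
`qubit_prediction_eq`).

Two errors remain. The normalization constants depend on the peak shift, but Poisson summation makes
them uniformly close to one value (`abs_combNorm_sub_le`). The parts $k\ne k_0$ have small total
weight `otherWeight`. Narrow Gaussians on a lattice are almost orthogonal, so $L^2$ norms reduce to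
$\ell^2$ norms of coefficients and both errors are controlled in `exists_rawOutput_approx`. The
distance to any multiple of the prediction then bounds the infidelity (`one_sub_fidelity_mul_le`).

For (i), `otherWeight_le` compares the other weights with the main one. For (ii), infidelity times
density is dominated by a small multiple of a Gaussian mixture whose integral is of order
$\Delta/\kappa$, which cancels a prefactor $\kappa/\Delta$. Results at which tracking may fail have
$t$ at distance at least $\frac12-r/\sqrt\pi>0$ from every integer, and there the density itself is
small. -/

/-! ### Gaussian sums over the integers, and general facts on series. -/

/-- The tail `∑_{j ≠ 0} exp (-a j²)` of a Gaussian sum over the integers. -/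
noncomputable def gaussTail (a : ℝ) : ℝ := ∑' j : ℤ, if j = 0 then 0 else Real.exp (-a * (j : ℝ) ^ 2)

lemma summable_exp_int_sq {a : ℝ} (ha : 0 < a) (q : ℝ) :
    Summable fun n : ℤ => Real.exp (-a * ((n : ℝ) + q) ^ 2) := by
  have h := (HurwitzZeta.hasSum_int_evenKernel q (t := a / Real.pi) (by positivity)).summable
  refine h.congr fun n => ?_
  congr 1
  field_simp

lemma summable_gaussTail {a : ℝ} (ha : 0 < a) :
    Summable fun j : ℤ => if j = 0 then 0 else Real.exp (-a * (j : ℝ) ^ 2) := by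
  have h := summable_exp_int_sq ha 0
  refine Summable.of_nonneg_of_le (fun j => ?_) (fun j => ?_) h
  · split_ifs <;> positivity
  · split_ifs
    · positivity
    · simp

lemma gaussTail_nonneg (a : ℝ) : 0 ≤ gaussTail a :=
  tsum_nonneg fun j => by split_ifs <;> positivity

/-- Nonzero integers have $j^2\ge1$, so $aj^2\ge(a-1)+j^2$. -/
lemma gaussTail_le {a : ℝ} (ha : 1 ≤ a) : gaussTail a ≤ Real.exp (-(a - 1)) * gaussTail 1 := by
  unfold gaussTail
  rw [← tsum_mul_left]
  refine (summable_gaussTail (by linarith)).tsum_le_tsum (fun j => ?_)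
    ((summable_gaussTail one_pos).mul_left _)
  split_ifs with h
  · simp
  · rw [← Real.exp_add]
    apply Real.exp_le_exp.2
    have : (1 : ℝ) ≤ (j : ℝ) ^ 2 := by
      have : (1 : ℤ) ≤ j ^ 2 := by
        have := sq_nonneg j; have : j ^ 2 ≠ 0 := by positivity
        omega
      exact_mod_cast this
    nlinarith

lemma tendsto_gaussTail : Tendsto gaussTail atTop (𝓝 0) := by
  have h : Tendsto (fun a : ℝ => Real.exp (-(a - 1)) * gaussTail 1) atTop (𝓝 (0 * gaussTail 1)) := by
    apply Tendsto.mul_const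
    exact Real.tendsto_exp_neg_atTop_nhds_zero.comp (tendsto_atTop_add_const_right _ _ tendsto_id)
  rw [zero_mul] at h
  refine tendsto_of_tendsto_of_tendsto_of_le_of_le' tendsto_const_nhds h
    (Eventually.of_forall gaussTail_nonneg) ?_
  filter_upwards [eventually_ge_atTop 1] with a ha using gaussTail_le ha

/-- `c / x² → ∞` as `x → 0`, so the tails `gaussTail (c / x²)` are small for small `x`. -/
lemma exists_gaussTail_div_sq_le {c : ℝ} (hc : 0 < c) {ε : ℝ} (hε : 0 < ε) :
    ∃ η : ℝ, 0 < η ∧ ∀ x : ℝ, 0 < x → x < η → gaussTail (c / x ^ 2) ≤ ε := by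
  obtain ⟨M, hM⟩ := eventually_atTop.1 (tendsto_gaussTail.eventually (ge_mem_nhds hε))
  refine ⟨√(c / (|M| + 1)), by positivity, fun x hx hxη => hM _ ?_⟩
  have h1 : x ^ 2 ≤ c / (|M| + 1) := by
    rw [← Real.sq_sqrt (show 0 ≤ c / (|M| + 1) by positivity)]
    exact pow_le_pow_left₀ hx.le hxη.le 2
  rw [le_div_iff₀ (by positivity)] at h1
  rw [le_div_iff₀ (by positivity)]
  nlinarith [le_abs_self M, sq_nonneg x]

/-- The Gaussian sum `∑ exp (-π τ (n + q)²)` is close to its integral, uniformly in `q`. -/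
lemma abs_tsum_exp_sub_le {τ : ℝ} (hτ : 0 < τ) (q : ℝ) :
    |(∑' n : ℤ, Real.exp (-(Real.pi * τ) * ((n : ℝ) + q) ^ 2)) - 1 / √τ| ≤
      1 / √τ * gaussTail (Real.pi / τ) := by
  have h1 : (∑' n : ℤ, Real.exp (-(Real.pi * τ) * ((n : ℝ) + q) ^ 2)) =
      HurwitzZeta.evenKernel q τ := by
    rw [← (HurwitzZeta.hasSum_int_evenKernel q hτ).tsum_eq]
    congr 1; ext n; congr 1; ring
  have hτ' : 0 < 1 / τ := by positivity
  have h3 := HurwitzZeta.hasSum_int_cosKernel q hτ'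
  have h2 : |HurwitzZeta.cosKernel q (1 / τ) - 1| ≤ gaussTail (Real.pi / τ) := by
    have h4 := hasSum_ite_sub_hasSum h3 0
    have h5 : ((HurwitzZeta.cosKernel q (1 / τ) - 1 : ℝ) : ℂ) =
        ∑' n : ℤ, if n = 0 then 0 else
          Complex.exp (2 * Real.pi * Complex.I * q * n) * Real.exp (-Real.pi * n ^ 2 * (1 / τ)) := by
      rw [h4.tsum_eq]; simp
    rw [← Real.norm_eq_abs, ← Complex.norm_real, h5]
    have hn : ∀ n : ℤ, ‖(if n = 0 then 0 else Complex.exp (2 * Real.pi * Complex.I * q * n) *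
        Real.exp (-Real.pi * n ^ 2 * (1 / τ)) : ℂ)‖ =
        if n = 0 then 0 else Real.exp (-(Real.pi / τ) * (n : ℝ) ^ 2) := by
      intro n
      split_ifs
      · simp
      · rw [norm_mul, show (2 * Real.pi * Complex.I * q * n : ℂ) =
          ((2 * Real.pi * q * n : ℝ) : ℂ) * Complex.I by push_cast; ring,
          Complex.norm_exp_ofReal_mul_I, one_mul, Complex.norm_real, Real.norm_eq_abs, Real.abs_exp]
        congr 1; ring
    have hs : Summable fun n : ℤ => ‖(if n = 0 then 0 else
        Complex.exp (2 * Real.pi * Complex.I * q * n) *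
        Real.exp (-Real.pi * n ^ 2 * (1 / τ)) : ℂ)‖ := by
      simp_rw [hn]; exact summable_gaussTail (by positivity)
    refine (norm_tsum_le_tsum_norm hs).trans (le_of_eq ?_)
    simp_rw [hn]; rfl
  -- Jacobi's functional equation: the zero frequency of the dual sum gives the integral
  -- $1/\sqrt\tau$, and `h2` bounds the other frequencies without regard to their phases, hence
  -- uniformly in `q`.
  rw [h1, HurwitzZeta.evenKernel_functional_equation, ← Real.sqrt_eq_rpow]
  rw [show 1 / √τ * HurwitzZeta.cosKernel q (1 / τ) - 1 / √τ =
    1 / √τ * (HurwitzZeta.cosKernel q (1 / τ) - 1) by ring, abs_mul, abs_of_nonneg (by positivity)]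
  gcongr

/-- Splitting a sum over the integers into even and odd terms. -/
lemma tsum_int_even_add_odd {E : Type*} [NormedAddCommGroup E] [CompleteSpace E] {f : ℤ → E}
    (hf : Summable f) : ∑' n, f n = ∑' s : ℤ, f (2 * s) + ∑' s : ℤ, f (2 * s + 1) := by
  have i0 : Function.Injective fun s : ℤ => 2 * s := fun a b h => by simpa using h
  have i1 : Function.Injective fun s : ℤ => 2 * s + 1 := fun a b h => by simpa using h
  have hc : IsCompl (Set.range fun s : ℤ => 2 * s) (Set.range fun s : ℤ => 2 * s + 1) := by
    constructor
    · rw [Set.disjoint_left]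
      rintro _ ⟨a, rfl⟩ ⟨b, hb⟩
      simp only at hb; omega
    · rw [codisjoint_iff_le_sup]
      intro n _
      rcases Int.even_or_odd' n with ⟨k, rfl | rfl⟩
      · exact Or.inl ⟨k, rfl⟩
      · exact Or.inr ⟨k, rfl⟩
  have h0 : HasSum (f ∘ Subtype.val : (Set.range fun s : ℤ => 2 * s) → E) (∑' s : ℤ, f (2 * s)) :=
    (i0.hasSum_range_iff (f := f)).2 (hf.comp_injective i0).hasSum
  have h1 : HasSum (f ∘ Subtype.val : (Set.range fun s : ℤ => 2 * s + 1) → E)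
      (∑' s : ℤ, f (2 * s + 1)) :=
    (i1.hasSum_range_iff (f := f)).2 (hf.comp_injective i1).hasSum
  exact (h0.add_isCompl hc h1).tsum_eq

lemma integrable_tsum_of_summable {α ι E : Type*} [MeasurableSpace α] [Countable ι]
    {μ : Measure α} [NormedAddCommGroup E] {F : ι → α → E}
    (hm : AEStronglyMeasurable (fun x => ∑' i, F i x) μ) (hF : ∀ i, Integrable (F i) μ)
    (hs : Summable fun i => ∫ x, ‖F i x‖ ∂μ) : Integrable (fun x => ∑' i, F i x) μ := by
  refine ⟨hm, ?_⟩
  rw [hasFiniteIntegral_iff_enorm]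
  refine lt_of_le_of_lt (lintegral_mono fun x => enorm_tsum_le_tsum_enorm) ?_
  rw [lintegral_tsum fun i => (hF i).1.enorm]
  have h (i : ι) : ∫⁻ x, ‖F i x‖ₑ ∂μ = ENNReal.ofReal (∫ x, ‖F i x‖ ∂μ) := by
    rw [ofReal_integral_norm_eq_lintegral_enorm (hF i)]
  simp_rw [h]
  rw [← ENNReal.ofReal_tsum_of_nonneg (fun i => integral_nonneg fun x => norm_nonneg _) hs]
  exact ENNReal.ofReal_lt_top

/-! ### Gaussian combs on a lattice and their $L^2$ norms. -/

lemma gauss_nonneg (σ z : ℝ) : 0 ≤ gauss σ z := (Real.exp_pos _).le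

lemma gauss_le_one (σ z : ℝ) : gauss σ z ≤ 1 := by
  unfold gauss
  rw [Real.exp_le_one_iff, neg_div]
  have : 0 ≤ z ^ 2 / (2 * σ ^ 2) := by positivity
  linarith

lemma gauss_neg (σ z : ℝ) : gauss σ (-z) = gauss σ z := by simp [gauss]

@[fun_prop]
lemma continuous_gauss (σ : ℝ) : Continuous (gauss σ) := by
  unfold gauss
  fun_prop

lemma gauss_div_sqrt_two (σ z : ℝ) : gauss (σ / √2) z = Real.exp (-(1 / σ ^ 2) * z ^ 2) := by
  unfold gauss
  rw [div_pow, Real.sq_sqrt (by norm_num)]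
  congr 1
  rw [show 2 * (σ ^ 2 / 2) = σ ^ 2 by ring]
  ring

/-- Completing the square. This is the source of the output width $\Delta/\sqrt2$ and of the
selection of peaks by the measurement. -/
lemma gauss_mul_gauss {σ : ℝ} (hσ : σ ≠ 0) (x p q : ℝ) : gauss σ (x - p) * gauss σ (x - q) =
    Real.exp (-(p - q) ^ 2 / (4 * σ ^ 2)) * gauss (σ / √2) (x - (p + q) / 2) := by
  rw [gauss_div_sqrt_two]
  unfold gauss
  rw [← Real.exp_add, ← Real.exp_add]
  congr 1
  field_simp
  ring

lemma integrable_gauss_div_sqrt_two {σ : ℝ} (hσ : 0 < σ) (c : ℝ) :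
    Integrable fun x => gauss (σ / √2) (x - c) := by
  simp_rw [gauss_div_sqrt_two]
  exact (integrable_exp_neg_mul_sq (by positivity)).comp_sub_right c

lemma integral_gauss_div_sqrt_two {σ : ℝ} (hσ : 0 < σ) (c : ℝ) :
    ∫ x, gauss (σ / √2) (x - c) = σ * √Real.pi := by
  rw [integral_sub_right_eq_self (gauss (σ / √2))]
  simp_rw [gauss_div_sqrt_two]
  rw [integral_gaussian, div_div_eq_mul_div, div_one, mul_comm,
    Real.sqrt_mul (by positivity), Real.sqrt_sq hσ.le]

/-- Superposition of Gaussians of width `σ` centered at the points `(n + q) L` of a lattice. -/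
noncomputable def latticeComb (L σ q : ℝ) (b : ℤ → ℂ) (x : ℝ) : ℂ :=
  ∑' n : ℤ, b n * (gauss σ (x - ((n : ℝ) + q) * L) : ℂ)

section
variable {L σ q : ℝ} {b : ℤ → ℂ}

lemma norm_mul_gauss_le (z : ℂ) (σ y : ℝ) : ‖z * (gauss σ y : ℂ)‖ ≤ ‖z‖ := by
  rw [norm_mul, Complex.norm_real, Real.norm_eq_abs, abs_of_nonneg (gauss_nonneg _ _)]
  exact mul_le_of_le_one_right (norm_nonneg _) (gauss_le_one _ _)

lemma summable_latticeComb (hb : Summable fun n => ‖b n‖) (x : ℝ) :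
    Summable fun n : ℤ => ‖b n * (gauss σ (x - ((n : ℝ) + q) * L) : ℂ)‖ :=
  Summable.of_nonneg_of_le (fun _ => norm_nonneg _) (fun _ => norm_mul_gauss_le _ _ _) hb

lemma continuous_latticeComb (hb : Summable fun n => ‖b n‖) :
    Continuous (latticeComb L σ q b) := by
  unfold latticeComb
  refine continuous_tsum (fun n => ?_) hb fun n x => norm_mul_gauss_le _ _ _
  exact continuous_const.mul (Complex.continuous_ofReal.comp
    ((continuous_gauss σ).comp (by fun_prop)))

lemma summable_norm_sq_of_summable_norm (hb : Summable fun n => ‖b n‖) :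
    Summable fun n => ‖b n‖ ^ 2 := by
  have h := hb.mul_norm hb |>.comp_injective (i := fun n : ℤ => (n, n))
    fun m n h => by simpa using h
  refine h.congr fun n => ?_
  simp [sq]

/-- Termwise $|zw|\le(|z|^2+|w|^2)/2$ and invariance of the sum under shifts: every off-diagonal of
the Gram expansion is at most the diagonal, up to its Gaussian factor. -/
lemma norm_tsum_shift_mul_le (hb : Summable fun n => ‖b n‖) (j : ℤ) :
    ‖∑' m : ℤ, b (j + m) * (starRingEnd ℂ) (b m)‖ ≤ ∑' n, ‖b n‖ ^ 2 := by
  have h2 := summable_norm_sq_of_summable_norm hb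
  have h3 : Summable fun m => ‖b (j + m)‖ ^ 2 := (Equiv.addLeft j).summable_iff.2 h2
  have hle : ∀ m, ‖b (j + m) * (starRingEnd ℂ) (b m)‖ ≤
      (‖b (j + m)‖ ^ 2 + ‖b m‖ ^ 2) / 2 := by
    intro m
    rw [norm_mul, RCLike.norm_conj]
    nlinarith [sq_nonneg (‖b (j + m)‖ - ‖b m‖)]
  have hs : Summable fun m => (‖b (j + m)‖ ^ 2 + ‖b m‖ ^ 2) / 2 := (h3.add h2).div_const 2
  refine (tsum_of_norm_bounded hs.hasSum hle).trans (le_of_eq ?_)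
  rw [tsum_div_const, h3.tsum_add h2, show ∑' m, ‖b (j + m)‖ ^ 2 = ∑' n, ‖b n‖ ^ 2 from
    (Equiv.addLeft j).tsum_eq fun n => ‖b n‖ ^ 2]
  ring

/-- The Gram expansion of the `L²` norm of a comb. -/
lemma gram_latticeComb (hσ : 0 < σ) (hb : Summable fun n => ‖b n‖) :
    Integrable (fun x => ‖latticeComb L σ q b x‖ ^ 2) ∧
    HasSum (fun p : ℤ × ℤ => b p.1 * (starRingEnd ℂ) (b p.2) *
      ((σ * √Real.pi * Real.exp (-(L ^ 2 / (4 * σ ^ 2)) * ((p.1 : ℝ) - p.2) ^ 2) : ℝ) : ℂ))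
      ((∫ x, ‖latticeComb L σ q b x‖ ^ 2 : ℝ) : ℂ) := by
  set F : ℤ × ℤ → ℝ → ℂ := fun p x => b p.1 * (starRingEnd ℂ) (b p.2) *
    ((Real.exp (-(L ^ 2 / (4 * σ ^ 2)) * ((p.1 : ℝ) - p.2) ^ 2) *
      gauss (σ / √2) (x - ((p.1 + q) * L + (p.2 + q) * L) / 2) : ℝ) : ℂ) with hF
  have hFeq : ∀ x, ∑' p, F p x = ((‖latticeComb L σ q b x‖ ^ 2 : ℝ) : ℂ) := by
    intro x
    rw [← Complex.normSq_eq_norm_sq, ← Complex.mul_conj]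
    unfold latticeComb
    rw [Complex.conj_tsum, tsum_mul_tsum_of_summable_norm (summable_latticeComb hb x)]
    · refine tsum_congr fun p => ?_
      rw [hF]
      simp only [map_mul, Complex.conj_ofReal]
      rw [show -(L ^ 2 / (4 * σ ^ 2)) * ((p.1 : ℝ) - p.2) ^ 2 =
        -((p.1 + q) * L - (p.2 + q) * L) ^ 2 / (4 * σ ^ 2) by ring, ← gauss_mul_gauss hσ.ne']
      push_cast
      ring
    · simpa only [RCLike.norm_conj] using summable_latticeComb hb x
  have hFi : ∀ p, Integrable (F p) := fun p =>
    (((integrable_gauss_div_sqrt_two hσ _).const_mul _).ofReal).const_mul _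
  have hprod : Summable fun p : ℤ × ℤ => ‖b p.1‖ * ‖b p.2‖ := by
    simpa using hb.mul_norm hb
  have hFn : ∀ p x, ‖F p x‖ = ‖b p.1‖ * ‖b p.2‖ *
    (Real.exp (-(L ^ 2 / (4 * σ ^ 2)) * ((p.1 : ℝ) - p.2) ^ 2) *
      gauss (σ / √2) (x - ((p.1 + q) * L + (p.2 + q) * L) / 2)) := by
    intro p x
    rw [hF]
    simp only
    rw [norm_mul, norm_mul, RCLike.norm_conj, Complex.norm_real, Real.norm_eq_abs,
      abs_of_nonneg (mul_nonneg (Real.exp_pos _).le (gauss_nonneg _ _))]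
  have hFs : Summable fun p => ∫ x, ‖F p x‖ := by
    refine Summable.of_nonneg_of_le (fun p => integral_nonneg fun x => norm_nonneg _) (fun p => ?_)
      (hprod.mul_right (σ * √Real.pi))
    simp_rw [hFn]
    rw [integral_const_mul, integral_const_mul, integral_gauss_div_sqrt_two hσ]
    refine mul_le_mul_of_nonneg_left (mul_le_of_le_one_left (by positivity) ?_) (by positivity)
    rw [Real.exp_le_one_iff, neg_mul, neg_nonpos]
    positivity
  have hc := (continuous_latticeComb (L := L) (σ := σ) (q := q) hb)
  constructor
  · have h := integrable_tsum_of_summable (F := F) (μ := volume) ?_ hFi hFs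
    · simp_rw [hFeq] at h
      simpa only [RCLike.re_to_complex, Complex.ofReal_re] using h.re
    · simp_rw [hFeq]
      exact Continuous.aestronglyMeasurable (by fun_prop)
  · have h := hasSum_integral_of_summable_integral_norm hFi hFs
    simp_rw [hFeq] at h
    rw [integral_complex_ofReal] at h
    refine h.congr_fun fun p => ?_
    rw [hF]
    simp only
    rw [integral_const_mul, integral_complex_ofReal, integral_const_mul,
      integral_gauss_div_sqrt_two hσ]
    congr 2
    ring

lemma integrable_norm_sq_latticeComb (hσ : 0 < σ) (hb : Summable fun n => ‖b n‖) :
    Integrable (fun x => ‖latticeComb L σ q b x‖ ^ 2) := (gram_latticeComb hσ hb).1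

/-- Gaussians on a lattice much coarser than their width are almost orthogonal. -/
lemma abs_integral_norm_sq_latticeComb_sub_le (hσ : 0 < σ) (hL : 0 < L)
    (hb : Summable fun n => ‖b n‖) :
    |(∫ x, ‖latticeComb L σ q b x‖ ^ 2) - σ * √Real.pi * ∑' n, ‖b n‖ ^ 2| ≤
      σ * √Real.pi * (∑' n, ‖b n‖ ^ 2) * gaussTail (L ^ 2 / (4 * σ ^ 2)) := by
  have h := (gram_latticeComb (L := L) (q := q) hσ hb).2
  set a := L ^ 2 / (4 * σ ^ 2) with ha
  have ha0 : 0 < a := by positivity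
  -- The overlap of two peaks depends only on the index difference, so the Gram sum is grouped by
  -- it: difference 0 is the main term, the rest adds up to a `gaussTail`.
  let e : ℤ × ℤ ≃ ℤ × ℤ :=
    { toFun := fun p => (p.1 + p.2, p.2)
      invFun := fun p => (p.1 - p.2, p.2)
      left_inv := fun p => by simp
      right_inv := fun p => by simp }
  have h1 := e.hasSum_iff.2 h
  set I := ∫ x, ‖latticeComb L σ q b x‖ ^ 2 with hI
  set c : ℤ → ℂ := fun j => ∑' m : ℤ, b (j + m) * (starRingEnd ℂ) (b m) with hcdef
  have h2 : HasSum (fun j : ℤ => ((σ * √Real.pi * Real.exp (-a * (j : ℝ) ^ 2) : ℝ) : ℂ) * c j)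
      (I : ℂ) := by
    refine (h1.prod_fiberwise fun j => (h1.summable.prod_factor j).hasSum).congr_fun fun j => ?_
    rw [hcdef]
    simp only
    rw [← tsum_mul_left]
    refine tsum_congr fun m => ?_
    simp only [Function.comp, e, Equiv.coe_fn_mk]
    rw [show ((j + m : ℤ) : ℝ) - m = j by push_cast; ring]
    ring
  have h3 := hasSum_ite_sub_hasSum h2 0
  have hc0 : c 0 = ((∑' n, ‖b n‖ ^ 2 : ℝ) : ℂ) := by
    rw [hcdef]
    simp only [zero_add]
    rw [Complex.ofReal_tsum]
    refine tsum_congr fun m => ?_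
    rw [Complex.mul_conj, Complex.normSq_eq_norm_sq]
  have hS0 : 0 ≤ ∑' n, ‖b n‖ ^ 2 := tsum_nonneg fun n => by positivity
  have h4 : ((I - σ * √Real.pi * ∑' n, ‖b n‖ ^ 2 : ℝ) : ℂ) =
      ∑' j : ℤ, if j = 0 then 0 else
        ((σ * √Real.pi * Real.exp (-a * (j : ℝ) ^ 2) : ℝ) : ℂ) * c j := by
    rw [h3.tsum_eq, hc0]
    simp
  rw [← Real.norm_eq_abs, ← Complex.norm_real, h4]
  have hs := (summable_gaussTail ha0).mul_left (σ * √Real.pi * ∑' n, ‖b n‖ ^ 2)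
  refine (tsum_of_norm_bounded hs.hasSum fun j => ?_).trans (le_of_eq ?_)
  · split_ifs
    · simp
    · rw [norm_mul, Complex.norm_real, Real.norm_eq_abs, abs_of_nonneg (by positivity)]
      have := norm_tsum_shift_mul_le hb j
      calc _ ≤ σ * √Real.pi * Real.exp (-a * (j : ℝ) ^ 2) * ∑' n, ‖b n‖ ^ 2 := by gcongr
        _ = _ := by ring
  · rw [tsum_mul_left]; rfl

lemma integral_norm_sq_latticeComb_le (hσ : 0 < σ) (hL : 0 < L)
    (hb : Summable fun n => ‖b n‖) (ht : gaussTail (L ^ 2 / (4 * σ ^ 2)) ≤ 1) :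
    ∫ x, ‖latticeComb L σ q b x‖ ^ 2 ≤ 2 * (σ * √Real.pi * ∑' n, ‖b n‖ ^ 2) := by
  have h := (abs_le.1 (abs_integral_norm_sq_latticeComb_sub_le (q := q) hσ hL hb)).2
  have hS0 : 0 ≤ σ * √Real.pi * ∑' n, ‖b n‖ ^ 2 :=
    mul_nonneg (by positivity) (tsum_nonneg fun n => by positivity)
  nlinarith

end

/-! ### Uniform asymptotics of the normalization constants. -/

lemma gaussTail_anti {a b : ℝ} (ha : 0 < a) (hab : a ≤ b) : gaussTail b ≤ gaussTail a := by
  unfold gaussTail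
  refine (summable_gaussTail (ha.trans_le hab)).tsum_le_tsum (fun j => ?_) (summable_gaussTail ha)
  split_ifs
  · rfl
  · apply Real.exp_le_exp.2
    nlinarith [sq_nonneg (j : ℝ)]

/-- The widths `Δ` and `κ` are so small that all Gaussian tails are at most `ε`. -/
def SmallTails (ε Δ κ : ℝ) : Prop :=
  0 < Δ ∧ 0 < κ ∧ gaussTail (Real.pi / 8 / Δ ^ 2) ≤ ε ∧ gaussTail (Real.pi / 8 / κ ^ 2) ≤ ε

lemma exists_smallTails {ε : ℝ} (hε : 0 < ε) : ∃ η : ℝ, 0 < η ∧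
    ∀ Δ κ : ℝ, 0 < Δ → Δ < η → 0 < κ → κ < η → SmallTails ε Δ κ := by
  obtain ⟨η, h0, h⟩ := exists_gaussTail_div_sq_le (c := Real.pi / 8) (by positivity) hε
  exact ⟨η, h0, fun Δ κ h1 h2 h3 h4 => ⟨h1, h3, h Δ h1 h2, h κ h3 h4⟩⟩

section
variable {ε Δ κ : ℝ}

lemma SmallTails.tail_left (h : SmallTails ε Δ κ) {a : ℝ} (ha : Real.pi / 8 / Δ ^ 2 ≤ a) :
    gaussTail a ≤ ε := by
  have := h.1
  exact (gaussTail_anti (by positivity) ha).trans h.2.2.1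

lemma SmallTails.tail_right (h : SmallTails ε Δ κ) {a : ℝ} (ha : Real.pi / 8 / κ ^ 2 ≤ a) :
    gaussTail a ≤ ε := by
  have := h.2.1
  exact (gaussTail_anti (by positivity) ha).trans h.2.2.2

/-- The asymptotic value of the normalization constants of the combs. -/
noncomputable def asympNorm (Δ κ : ℝ) : ℝ := √(2 * κ / (√Real.pi * Δ))

lemma gauss_inv_eq (κ z : ℝ) : gauss (1 / κ) (z * √Real.pi) =
    Real.exp (-(Real.pi * κ ^ 2 / 2) * z ^ 2) := by
  unfold gauss
  rw [mul_pow, Real.sq_sqrt Real.pi_pos.le]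
  congr 1
  -- For `κ = 0` division by zero makes both exponents 0.
  rcases eq_or_ne κ 0 with rfl | h
  · simp
  · field_simp

lemma summable_gauss_inv (hκ : 0 < κ) (q : ℝ) :
    Summable fun n : ℤ => gauss (1 / κ) (((n : ℝ) + q) * √Real.pi) := by
  simp_rw [gauss_inv_eq]
  exact summable_exp_int_sq (by positivity) q

lemma summable_comb_coeff (hκ : 0 < κ) (μ : ℝ) :
    Summable fun s : ℤ => gauss (1 / κ) ((2 * (s : ℝ) + μ) * √Real.pi) := by
  have h := (summable_gauss_inv hκ μ).comp_injective (i := fun s : ℤ => 2 * s)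
    fun a b h => by simpa using h
  refine h.congr fun s => ?_
  simp

lemma comb_eq_latticeComb (Δ κ μ x : ℝ) : (comb Δ κ μ x : ℂ) =
    latticeComb (2 * √Real.pi) Δ (μ / 2)
      (fun s : ℤ => (gauss (1 / κ) ((2 * (s : ℝ) + μ) * √Real.pi) : ℂ)) x := by
  unfold comb latticeComb
  rw [Complex.ofReal_tsum]
  refine tsum_congr fun s => ?_
  rw [Complex.ofReal_mul, show ((s : ℝ) + μ / 2) * (2 * √Real.pi) = (2 * s + μ) * √Real.pi by ring]

/-- The sum of the squared envelope of a comb. -/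
noncomputable def envelopeSum (κ μ : ℝ) : ℝ :=
  ∑' s : ℤ, gauss (1 / κ) ((2 * (s : ℝ) + μ) * √Real.pi) ^ 2

lemma summable_comb_coeff_norm (hκ : 0 < κ) (μ : ℝ) :
    Summable fun s : ℤ => ‖(gauss (1 / κ) ((2 * (s : ℝ) + μ) * √Real.pi) : ℂ)‖ := by
  refine (summable_comb_coeff hκ μ).congr fun s => ?_
  rw [Complex.norm_real, Real.norm_eq_abs, abs_of_nonneg (gauss_nonneg _ _)]

lemma abs_envelopeSum_sub_le (h : SmallTails ε Δ κ) (μ : ℝ) :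
    |envelopeSum κ μ - 1 / (2 * κ)| ≤ 1 / (2 * κ) * ε := by
  have hκ := h.2.1
  have h1 := abs_tsum_exp_sub_le (τ := 4 * κ ^ 2) (by positivity) (μ / 2)
  have h2 : √(4 * κ ^ 2) = 2 * κ := by
    rw [show 4 * κ ^ 2 = (2 * κ) ^ 2 by ring, Real.sqrt_sq (by positivity)]
  rw [h2] at h1
  have h3 : envelopeSum κ μ =
      ∑' n : ℤ, Real.exp (-(Real.pi * (4 * κ ^ 2)) * ((n : ℝ) + μ / 2) ^ 2) := by
    unfold envelopeSum
    refine tsum_congr fun s => ?_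
    rw [gauss_inv_eq, ← Real.exp_nat_mul]
    congr 1
    push_cast
    ring
  rw [h3]
  refine h1.trans (mul_le_mul_of_nonneg_left (h.tail_right ?_) (by positivity))
  rw [div_div]
  gcongr
  nlinarith

lemma abs_integral_comb_sq_sub_le (h : SmallTails ε Δ κ) (μ : ℝ) :
    |(∫ x, comb Δ κ μ x ^ 2) - Δ * √Real.pi * envelopeSum κ μ| ≤
      Δ * √Real.pi * envelopeSum κ μ * ε := by
  have hΔ := h.1
  have h1 := abs_integral_norm_sq_latticeComb_sub_le (L := 2 * √Real.pi) (q := μ / 2) hΔ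
    (by positivity) (summable_comb_coeff_norm h.2.1 μ)
  simp_rw [← comb_eq_latticeComb, Complex.norm_real, Real.norm_eq_abs, sq_abs] at h1
  refine h1.trans (mul_le_mul_of_nonneg_left (h.tail_left ?_) ?_)
  · rw [mul_pow, Real.sq_sqrt Real.pi_pos.le, div_div]
    rw [div_le_div_iff₀ (by positivity) (by positivity)]
    nlinarith [mul_pos Real.pi_pos (sq_pos_of_pos hΔ)]
  · exact mul_nonneg (by positivity) (tsum_nonneg fun n => by positivity)

lemma envelopeSum_pos (hε : ε < 1) (h : SmallTails ε Δ κ) (μ : ℝ) : 0 < envelopeSum κ μ := by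
  have hκ := h.2.1
  have h1 := (abs_le.1 (abs_envelopeSum_sub_le h μ)).1
  have : 0 < 1 / (2 * κ) := by positivity
  nlinarith

lemma integral_comb_sq_pos (hε : ε < 1) (h : SmallTails ε Δ κ) (μ : ℝ) :
    0 < ∫ x, comb Δ κ μ x ^ 2 := by
  have h1 := (abs_le.1 (abs_integral_comb_sq_sub_le h μ)).1
  have h2 := envelopeSum_pos hε h μ
  have hΔ := h.1
  have : 0 < Δ * √Real.pi * envelopeSum κ μ := by positivity
  nlinarith

lemma combNorm_pos (hε : ε < 1) (h : SmallTails ε Δ κ) (μ : ℝ) : 0 < combNorm Δ κ μ := by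
  have := integral_comb_sq_pos hε h μ
  unfold combNorm
  positivity

lemma asympNorm_pos (h : SmallTails ε Δ κ) : 0 < asympNorm Δ κ := by
  have h1 := h.1
  have h2 := h.2.1
  unfold asympNorm
  positivity

lemma one_le_combNorm_sq_mul (hε : ε < 1) (h : SmallTails ε Δ κ) (μ : ℝ) :
    1 ≤ combNorm Δ κ μ ^ 2 * (Δ * √Real.pi * envelopeSum κ μ) * (1 + ε) := by
  have h1 := (abs_le.1 (abs_integral_comb_sq_sub_le h μ)).2
  have h2 := integral_comb_sq_pos hε h μ
  unfold combNorm
  rw [inv_pow, Real.sq_sqrt h2.le, mul_assoc, inv_mul_eq_div, le_div_iff₀ h2]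
  linarith

/-- The normalization constants are uniformly close to their common asymptotic value. -/
lemma abs_combNorm_sub_le (hε0 : 0 ≤ ε) (hε : ε ≤ 1 / 2) (h : SmallTails ε Δ κ) (μ : ℝ) :
    |combNorm Δ κ μ - asympNorm Δ κ| ≤ 2 * ε * asympNorm Δ κ := by
  have hΔ := h.1
  have hκ := h.2.1
  have hI := integral_comb_sq_pos (by linarith) h μ
  have hN := combNorm_pos (by linarith) h μ
  have hν := asympNorm_pos h
  have h1 := abs_le.1 (abs_integral_comb_sq_sub_le h μ)
  have h2 := abs_le.1 (abs_envelopeSum_sub_le h μ)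
  have hNI : combNorm Δ κ μ ^ 2 * (∫ x, comb Δ κ μ x ^ 2) = 1 := by
    unfold combNorm
    rw [inv_pow, Real.sq_sqrt hI.le, inv_mul_cancel₀ hI.ne']
  have hν2 : asympNorm Δ κ ^ 2 * (Δ * √Real.pi * (1 / (2 * κ))) = 1 := by
    unfold asympNorm
    rw [Real.sq_sqrt (by positivity)]
    field_simp
  set I := ∫ x, comb Δ κ μ x ^ 2
  set N := combNorm Δ κ μ
  set ν := asympNorm Δ κ
  set c := Δ * √Real.pi
  have hc : 0 < c := by positivity
  set S := envelopeSum κ μ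
  set d := 1 / (2 * κ)
  have hd : 0 < d := by positivity
  have hIu : I ≤ (1 + ε) ^ 2 * (c * d) := by
    have : c * S ≤ c * (d * (1 + ε)) := mul_le_mul_of_nonneg_left (by linarith) hc.le
    nlinarith
  have hIl : (1 - ε) ^ 2 * (c * d) ≤ I := by
    have : c * (d * (1 - ε)) ≤ c * S := mul_le_mul_of_nonneg_left (by linarith) hc.le
    nlinarith
  have hcd : 0 < c * d := by positivity
  -- Since $N^2I=1=\nu^2cd$, bounds on $I/(cd)$ by $(1\pm\varepsilon)^2$ become bounds on $\nu/N$ by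
  -- $1\pm\varepsilon$.
  have hup : N * (1 - ε) ≤ ν := by
    refine (pow_le_pow_iff_left₀ (mul_nonneg hN.le (by linarith)) hν.le two_ne_zero).1 ?_
    refine le_of_mul_le_mul_right ?_ hcd
    rw [hν2]
    linarith [mul_le_mul_of_nonneg_left hIl (sq_nonneg N)]
  have hlo : ν ≤ N * (1 + ε) := by
    refine (pow_le_pow_iff_left₀ hν.le (by positivity) two_ne_zero).1 ?_
    refine le_of_mul_le_mul_right ?_ hcd
    rw [hν2]
    linarith [mul_le_mul_of_nonneg_left hIu (sq_nonneg N)]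
  rw [abs_le]
  constructor <;> nlinarith [mul_nonneg hε0 hν.le, mul_nonneg hε0 hN.le]

/-! ### The qubit as a single comb of spacing $\sqrt\pi$. -/

/-- The coefficients of the qubit wavefunction without its envelope. -/
noncomputable def qubitAmp (a₀ a₁ : ℂ) (Δ κ α : ℝ) (n : ℤ) : ℂ :=
  if Even n then a₀ * combNorm Δ κ α else a₁ * combNorm Δ κ (1 + α)

/-- The coefficients of the qubit wavefunction. -/
noncomputable def qubitCoeff (a₀ a₁ : ℂ) (Δ κ α : ℝ) (n : ℤ) : ℂ :=
  qubitAmp a₀ a₁ Δ κ α n * (gauss (1 / κ) (((n : ℝ) + α) * √Real.pi) : ℂ)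

lemma qubitAmp_even (a₀ a₁ : ℂ) (Δ κ α : ℝ) (s : ℤ) :
    qubitAmp a₀ a₁ Δ κ α (2 * s) = a₀ * combNorm Δ κ α := by simp [qubitAmp]

lemma qubitAmp_odd (a₀ a₁ : ℂ) (Δ κ α : ℝ) (s : ℤ) :
    qubitAmp a₀ a₁ Δ κ α (2 * s + 1) = a₁ * combNorm Δ κ (1 + α) := by simp [qubitAmp]

lemma norm_qubitAmp_le (a₀ a₁ : ℂ) (Δ κ α : ℝ) (n : ℤ) : ‖qubitAmp a₀ a₁ Δ κ α n‖ ≤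
    ‖a₀ * combNorm Δ κ α‖ + ‖a₁ * combNorm Δ κ (1 + α)‖ := by
  unfold qubitAmp
  split_ifs
  · exact le_add_of_nonneg_right (norm_nonneg _)
  · exact le_add_of_nonneg_left (norm_nonneg _)

lemma norm_mul_gauss (z : ℂ) (σ y : ℝ) : ‖z * (gauss σ y : ℂ)‖ = ‖z‖ * gauss σ y := by
  rw [norm_mul, Complex.norm_real, Real.norm_eq_abs, abs_of_nonneg (gauss_nonneg _ _)]

lemma summable_qubitCoeff (a₀ a₁ : ℂ) (Δ : ℝ) (hκ : 0 < κ) (α : ℝ) :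
    Summable fun n => ‖qubitCoeff a₀ a₁ Δ κ α n‖ := by
  refine Summable.of_nonneg_of_le (fun _ => norm_nonneg _) (fun n => ?_)
    ((summable_gauss_inv hκ α).mul_left
      (‖a₀ * combNorm Δ κ α‖ + ‖a₁ * combNorm Δ κ (1 + α)‖))
  unfold qubitCoeff
  rw [norm_mul_gauss]
  exact mul_le_mul_of_nonneg_right (norm_qubitAmp_le _ _ _ _ _ _) (gauss_nonneg _ _)

/-- The peaks of $\psi_\alpha$ and $\psi_{1+\alpha}$ are the even and odd sites of one lattice, so
the qubit is encoded in the parity of the site. -/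
lemma qubit_eq_latticeComb (a₀ a₁ : ℂ) (Δ : ℝ) (hκ : 0 < κ) (α x : ℝ) :
    qubit a₀ a₁ Δ κ α x = latticeComb √Real.pi Δ α (qubitCoeff a₀ a₁ Δ κ α) x := by
  unfold latticeComb
  rw [tsum_int_even_add_odd (summable_latticeComb (summable_qubitCoeff a₀ a₁ Δ hκ α) x).of_norm]
  unfold qubit psi comb
  push_cast
  rw [← mul_assoc, ← mul_assoc, ← tsum_mul_left, ← tsum_mul_left]
  congr 1
  · refine tsum_congr fun s => ?_
    rw [qubitCoeff, qubitAmp_even]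
    push_cast
    ring
  · refine tsum_congr fun s => ?_
    rw [qubitCoeff, qubitAmp_odd]
    push_cast
    rw [show (2 * (s : ℝ) + (1 + α)) = 2 * s + 1 + α by ring]
    ring

lemma continuous_qubit (a₀ a₁ : ℂ) (Δ : ℝ) (hκ : 0 < κ) (α : ℝ) :
    Continuous (qubit a₀ a₁ Δ κ α) := by
  rw [show qubit a₀ a₁ Δ κ α = latticeComb √Real.pi Δ α (qubitCoeff a₀ a₁ Δ κ α) from
    funext (qubit_eq_latticeComb a₀ a₁ Δ hκ α)]
  exact continuous_latticeComb (summable_qubitCoeff a₀ a₁ Δ hκ α)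

lemma integrable_norm_sq_qubit (a₀ a₁ : ℂ) (hΔ : 0 < Δ) (hκ : 0 < κ) (α : ℝ) :
    Integrable fun x => ‖qubit a₀ a₁ Δ κ α x‖ ^ 2 := by
  simp_rw [qubit_eq_latticeComb a₀ a₁ Δ hκ α]
  exact integrable_norm_sq_latticeComb hΔ (summable_qubitCoeff a₀ a₁ Δ hκ α)

lemma tsum_norm_sq_qubitCoeff (a₀ a₁ : ℂ) (Δ : ℝ) (hκ : 0 < κ) (α : ℝ) :
    ∑' n, ‖qubitCoeff a₀ a₁ Δ κ α n‖ ^ 2 = ‖a₀‖ ^ 2 * (combNorm Δ κ α ^ 2 * envelopeSum κ α) +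
      ‖a₁‖ ^ 2 * (combNorm Δ κ (1 + α) ^ 2 * envelopeSum κ (1 + α)) := by
  rw [tsum_int_even_add_odd
    (summable_norm_sq_of_summable_norm (summable_qubitCoeff a₀ a₁ Δ hκ α))]
  unfold envelopeSum
  rw [← mul_assoc, ← mul_assoc, ← tsum_mul_left, ← tsum_mul_left]
  congr 1
  · refine tsum_congr fun s => ?_
    rw [qubitCoeff, qubitAmp_even, norm_mul_gauss, norm_mul, Complex.norm_real, mul_pow, mul_pow,
      Real.norm_eq_abs, sq_abs]
    push_cast
    ring
  · refine tsum_congr fun s => ?_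
    rw [qubitCoeff, qubitAmp_odd, norm_mul_gauss, norm_mul, Complex.norm_real, mul_pow, mul_pow,
      Real.norm_eq_abs, sq_abs]
    push_cast
    rw [show (2 * (s : ℝ) + (1 + α)) = 2 * s + 1 + α by ring]

/-- The two basis wavefunctions are almost orthonormal. -/
lemma le_integral_norm_sq_qubit (hε0 : 0 ≤ ε) (hε : ε ≤ 1 / 3) (h : SmallTails ε Δ κ) (a₀ a₁ : ℂ)
    (α : ℝ) : (‖a₀‖ ^ 2 + ‖a₁‖ ^ 2) / 2 ≤ ∫ x, ‖qubit a₀ a₁ Δ κ α x‖ ^ 2 := by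
  have hΔ := h.1
  have hκ := h.2.1
  simp_rw [qubit_eq_latticeComb a₀ a₁ Δ hκ α]
  have h1 := (abs_le.1 (abs_integral_norm_sq_latticeComb_sub_le (L := √Real.pi) (q := α) hΔ
    (by positivity) (summable_qubitCoeff a₀ a₁ Δ hκ α))).1
  have h2 : gaussTail (√Real.pi ^ 2 / (4 * Δ ^ 2)) ≤ ε := by
    refine h.tail_left ?_
    rw [Real.sq_sqrt Real.pi_pos.le, div_div]
    gcongr
    norm_num
  rw [tsum_norm_sq_qubitCoeff a₀ a₁ Δ hκ α] at h1
  have e0 := one_le_combNorm_sq_mul (by linarith) h α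
  have e1 := one_le_combNorm_sq_mul (by linarith) h (1 + α)
  set x0 := combNorm Δ κ α ^ 2 * (Δ * √Real.pi * envelopeSum κ α)
  set x1 := combNorm Δ κ (1 + α) ^ 2 * (Δ * √Real.pi * envelopeSum κ (1 + α))
  have hX : Δ * √Real.pi * (‖a₀‖ ^ 2 * (combNorm Δ κ α ^ 2 * envelopeSum κ α) +
      ‖a₁‖ ^ 2 * (combNorm Δ κ (1 + α) ^ 2 * envelopeSum κ (1 + α))) =
      ‖a₀‖ ^ 2 * x0 + ‖a₁‖ ^ 2 * x1 := by ring
  rw [hX] at h1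
  -- $3/4=1/(1+\frac13)$; the off-diagonal loss of at most one third then leaves the factor
  -- $\frac12$.
  have f0 : 3 / 4 ≤ x0 := by nlinarith
  have f1 : 3 / 4 ≤ x1 := by nlinarith
  set X := ‖a₀‖ ^ 2 * x0 + ‖a₁‖ ^ 2 * x1 with hXd
  have hXl : 3 / 4 * (‖a₀‖ ^ 2 + ‖a₁‖ ^ 2) ≤ X := by
    rw [hXd, mul_add]
    nlinarith [mul_le_mul_of_nonneg_left f0 (sq_nonneg ‖a₀‖),
      mul_le_mul_of_nonneg_left f1 (sq_nonneg ‖a₁‖)]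
  have hX0 : 0 ≤ X := le_trans (by positivity) hXl
  have : X * gaussTail (√Real.pi ^ 2 / (4 * Δ ^ 2)) ≤ X * (1 / 3) :=
    mul_le_mul_of_nonneg_left (h2.trans hε) hX0
  linarith

end

/-! ### Products of two combs. -/

section pair

/-- Term of the product of two combs: the coefficients `γ`, `δ`, a weight `τ` depending on the sum
and an envelope `e` depending on the difference of the two indices, and a Gaussian centered at a
lattice point depending on the difference. -/
noncomputable def pairTerm (L σ q : ℝ) (γ δ : ℤ → ℂ) (e τ : ℤ → ℝ) (x : ℝ) (p : ℤ × ℤ) : ℂ :=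
  γ p.1 * δ p.2 * (τ (p.1 + p.2) : ℂ) * (e (p.1 - p.2) : ℂ) *
    (gauss σ (x - (((p.1 - p.2 : ℤ) : ℝ) + q) * L) : ℂ)

variable {L σ q : ℝ} {γ δ : ℤ → ℂ} {e τ : ℤ → ℝ} {c d : ℝ}

/-- The map $(n,m)\mapsto(n+m,n-m)$ is injective but misses pairs of unequal parity; injectivity
suffices for summability. -/
lemma summable_pair_weights (he : Summable e) (he0 : ∀ j, 0 ≤ e j) (hτ : Summable τ)
    (hτ0 : ∀ k, 0 ≤ τ k) : Summable fun p : ℤ × ℤ => τ (p.1 + p.2) * e (p.1 - p.2) := by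
  have h := hτ.mul_of_nonneg he hτ0 he0
  refine h.comp_injective (i := fun p : ℤ × ℤ => (p.1 + p.2, p.1 - p.2)) fun p r h => ?_
  simp only [Prod.mk.injEq] at h
  ext <;> omega

lemma norm_pairTerm_le (hγ : ∀ n, ‖γ n‖ ≤ c) (hδ : ∀ n, ‖δ n‖ ≤ d) (he0 : ∀ j, 0 ≤ e j)
    (hτ0 : ∀ k, 0 ≤ τ k) (x : ℝ) (p : ℤ × ℤ) : ‖pairTerm L σ q γ δ e τ x p‖ ≤
      c * d * (τ (p.1 + p.2) * e (p.1 - p.2)) := by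
  unfold pairTerm
  refine (norm_mul_gauss_le _ _ _).trans ?_
  rw [norm_mul, norm_mul, norm_mul, Complex.norm_real, Complex.norm_real, Real.norm_eq_abs,
    Real.norm_eq_abs, abs_of_nonneg (hτ0 _), abs_of_nonneg (he0 _), mul_assoc]
  have hc : 0 ≤ c := (norm_nonneg _).trans (hγ 0)
  refine mul_le_mul_of_nonneg_right ?_ (mul_nonneg (hτ0 _) (he0 _))
  exact mul_le_mul (hγ _) (hδ _) (norm_nonneg _) hc

lemma summable_norm_pairTerm (hγ : ∀ n, ‖γ n‖ ≤ c) (hδ : ∀ n, ‖δ n‖ ≤ d) (he : Summable e)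
    (he0 : ∀ j, 0 ≤ e j) (hτ : Summable τ) (hτ0 : ∀ k, 0 ≤ τ k) (x : ℝ) :
    Summable fun p => ‖pairTerm L σ q γ δ e τ x p‖ :=
  Summable.of_nonneg_of_le (fun _ => norm_nonneg _) (norm_pairTerm_le hγ hδ he0 hτ0 x)
    ((summable_pair_weights he he0 hτ hτ0).mul_left _)

/-- The coefficients of a product of two combs as a comb. -/
noncomputable def pairCoeff (γ δ : ℤ → ℂ) (e τ : ℤ → ℝ) (j : ℤ) : ℂ :=
  (∑' m : ℤ, γ (j + m) * δ m * (τ (j + 2 * m) : ℂ)) * (e j : ℂ)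

lemma injective_add_two_mul (j : ℤ) : Function.Injective fun m : ℤ => j + 2 * m :=
  fun a b h => by simpa using h

/-- At difference $j$ only index sums of the parity of $j$ occur, so their weights add up to at most
the full sum. Hence the $L^2$ norm of a product of combs is controlled by the total weight. -/
lemma norm_pairCoeff_le (hγ : ∀ n, ‖γ n‖ ≤ c) (hδ : ∀ n, ‖δ n‖ ≤ d) (he0 : ∀ j, 0 ≤ e j)
    (hτ : Summable τ) (hτ0 : ∀ k, 0 ≤ τ k) (j : ℤ) :
    ‖pairCoeff γ δ e τ j‖ ≤ c * d * (∑' k, τ k) * e j := by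
  unfold pairCoeff
  rw [norm_mul, Complex.norm_real, Real.norm_eq_abs, abs_of_nonneg (he0 _)]
  refine mul_le_mul_of_nonneg_right ?_ (he0 _)
  have hc : 0 ≤ c := (norm_nonneg _).trans (hγ 0)
  have hd : 0 ≤ d := (norm_nonneg _).trans (hδ 0)
  have h1 : Summable fun m => τ (j + 2 * m) := hτ.comp_injective (injective_add_two_mul j)
  refine (tsum_of_norm_bounded (h1.mul_left (c * d)).hasSum fun m => ?_).trans ?_
  · rw [norm_mul, norm_mul, Complex.norm_real, Real.norm_eq_abs, abs_of_nonneg (hτ0 _)]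
    exact mul_le_mul_of_nonneg_right (mul_le_mul (hγ _) (hδ _) (norm_nonneg _) hc) (hτ0 _)
  · rw [tsum_mul_left]
    exact mul_le_mul_of_nonneg_left
      (tsum_comp_le_tsum_of_inj hτ hτ0 (injective_add_two_mul j)) (by positivity)

lemma summable_norm_pairCoeff (hγ : ∀ n, ‖γ n‖ ≤ c) (hδ : ∀ n, ‖δ n‖ ≤ d) (he : Summable e)
    (he0 : ∀ j, 0 ≤ e j) (hτ : Summable τ) (hτ0 : ∀ k, 0 ≤ τ k) :
    Summable fun j => ‖pairCoeff γ δ e τ j‖ :=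
  Summable.of_nonneg_of_le (fun _ => norm_nonneg _) (norm_pairCoeff_le hγ hδ he0 hτ hτ0)
    (he.mul_left _)

/-- Pairs with the same difference carry the same Gaussian; summing over them first leaves a comb,
to which the $L^2$ bounds apply. -/
lemma tsum_pairTerm_eq_latticeComb (hγ : ∀ n, ‖γ n‖ ≤ c) (hδ : ∀ n, ‖δ n‖ ≤ d) (he : Summable e)
    (he0 : ∀ j, 0 ≤ e j) (hτ : Summable τ) (hτ0 : ∀ k, 0 ≤ τ k) (x : ℝ) :
    ∑' p, pairTerm L σ q γ δ e τ x p = latticeComb L σ q (pairCoeff γ δ e τ) x := by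
  let E : ℤ × ℤ ≃ ℤ × ℤ :=
    { toFun := fun p => (p.1 + p.2, p.2)
      invFun := fun p => (p.1 - p.2, p.2)
      left_inv := fun p => by simp
      right_inv := fun p => by simp }
  have hs := (summable_norm_pairTerm (L := L) (σ := σ) (q := q) hγ hδ he he0 hτ hτ0 x).of_norm
  have hs' := E.summable_iff.2 hs
  simp only [Function.comp_def] at hs'
  rw [← E.tsum_eq, hs'.tsum_prod]
  unfold latticeComb
  refine tsum_congr fun j => ?_
  unfold pairCoeff
  rw [mul_assoc, ← tsum_mul_right]
  refine tsum_congr fun m => ?_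
  simp only [pairTerm, E, Equiv.coe_fn_mk, add_sub_cancel_right]
  rw [show j + m + m = j + 2 * m by ring]
  ring

lemma integral_norm_sq_latticeComb_le_of_le {b : ℤ → ℂ} (hσ : 0 < σ) (hL : 0 < L)
    (ht : gaussTail (L ^ 2 / (4 * σ ^ 2)) ≤ 1) {M : ℝ} (he : Summable e)
    (he2 : Summable fun j => e j ^ 2) (hb : ∀ j, ‖b j‖ ≤ M * e j) :
    ∫ x, ‖latticeComb L σ q b x‖ ^ 2 ≤ 2 * (σ * √Real.pi * (M ^ 2 * ∑' j, e j ^ 2)) := by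
  have hs : Summable fun j => ‖b j‖ :=
    Summable.of_nonneg_of_le (fun _ => norm_nonneg _) hb (he.mul_left _)
  refine (integral_norm_sq_latticeComb_le hσ hL hs ht).trans ?_
  have h : ∑' n, ‖b n‖ ^ 2 ≤ M ^ 2 * ∑' j, e j ^ 2 := by
    rw [← tsum_mul_left]
    refine (summable_norm_sq_of_summable_norm hs).tsum_le_tsum (fun j => ?_) (he2.mul_left _)
    rw [← mul_pow]
    exact pow_le_pow_left₀ (norm_nonneg _) (hb j) 2
  gcongr

/-- The part of a product of two combs where the index sum is `k₀`, separated. -/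
lemma tsum_pairTerm_split (hγ : ∀ n, ‖γ n‖ ≤ c) (hδ : ∀ n, ‖δ n‖ ≤ d) (he : Summable e)
    (he0 : ∀ j, 0 ≤ e j) (hτ : Summable τ) (hτ0 : ∀ k, 0 ≤ τ k) (x : ℝ) (k₀ : ℤ) :
    ∑' p, pairTerm L σ q γ δ e τ x p =
      (∑' n : ℤ, γ n * δ (k₀ - n) * (τ k₀ : ℂ) * (e (2 * n - k₀) : ℂ) *
        (gauss σ (x - ((2 * (n : ℝ) - k₀) + q) * L) : ℂ)) +
      ∑' p, pairTerm L σ q γ δ e (fun k => if k = k₀ then 0 else τ k) x p := by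
  have hle : ∀ k, (if k = k₀ then 0 else τ k) ≤ τ k := fun k => by
    split_ifs
    · exact hτ0 k
    · rfl
  have h0 : ∀ k, 0 ≤ (if k = k₀ then 0 else τ k) := fun k => by
    split_ifs
    · exact le_rfl
    · exact hτ0 k
  have h1 := (summable_norm_pairTerm (L := L) (σ := σ) (q := q) hγ hδ he he0 hτ hτ0 x).of_norm
  have h2 := (summable_norm_pairTerm (L := L) (σ := σ) (q := q) hγ hδ he he0
    (Summable.of_nonneg_of_le h0 hle hτ) h0 x).of_norm
  rw [← sub_eq_iff_eq_add, ← h1.tsum_sub h2]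
  have hi : Function.Injective fun n : ℤ => (n, k₀ - n) := fun a b h => by
    simp only [Prod.mk.injEq] at h; exact h.1
  -- The two series differ only on the antidiagonal $n+m=k_0$, parametrized by $n$.
  rw [← hi.tsum_eq]
  · refine tsum_congr fun n => ?_
    simp only [pairTerm]
    rw [show n + (k₀ - n) = k₀ by ring, show n - (k₀ - n) = 2 * n - k₀ by ring]
    simp
  · intro p hp
    by_contra hne
    apply hp
    have : p.1 + p.2 ≠ k₀ := fun h => hne ⟨p.1, by ext <;> simp; omega⟩
    simp [pairTerm, this]

end pair

/-! ### The output for a fixed measurement result. -/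

/-- The envelope of the output comb. -/
noncomputable def outEnvelope (κ α : ℝ) (j : ℤ) : ℝ :=
  Real.exp (-(Real.pi * κ ^ 2 / 4) * ((j : ℝ) + α) ^ 2)

/-- The amplitude of the contribution of the peaks whose index sum is `k`, when the rescaled and
shifted measurement result is `t`. -/
noncomputable def peakWeight (Δ κ α t : ℝ) (k : ℤ) : ℝ :=
  outEnvelope κ α k * Real.exp (-(Real.pi / (4 * Δ ^ 2)) * (t - k) ^ 2)

section
variable {ε Δ κ : ℝ}

lemma outEnvelope_pos (κ α : ℝ) (j : ℤ) : 0 < outEnvelope κ α j := Real.exp_pos _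

lemma peakWeight_pos (Δ κ α t : ℝ) (k : ℤ) : 0 < peakWeight Δ κ α t k :=
  mul_pos (outEnvelope_pos _ _ _) (Real.exp_pos _)

lemma summable_outEnvelope (hκ : 0 < κ) (α : ℝ) : Summable (outEnvelope κ α) :=
  summable_exp_int_sq (by positivity) α

lemma peakWeight_le_outEnvelope (Δ κ α t : ℝ) (k : ℤ) :
    peakWeight Δ κ α t k ≤ outEnvelope κ α k := by
  refine mul_le_of_le_one_right (outEnvelope_pos _ _ _).le ?_
  rw [Real.exp_le_one_iff, neg_mul, neg_nonpos]
  positivity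

lemma summable_peakWeight (Δ : ℝ) (hκ : 0 < κ) (α t : ℝ) : Summable (peakWeight Δ κ α t) :=
  Summable.of_nonneg_of_le (fun k => (peakWeight_pos _ _ _ _ k).le)
    (peakWeight_le_outEnvelope Δ κ α t) (summable_outEnvelope hκ α)

lemma outEnvelope_sq (κ α : ℝ) (j : ℤ) : outEnvelope κ α j ^ 2 =
    Real.exp (-(Real.pi * (κ ^ 2 / 2)) * ((j : ℝ) + α) ^ 2) := by
  unfold outEnvelope
  rw [← Real.exp_nat_mul]
  congr 1
  push_cast
  ring

lemma summable_outEnvelope_sq (hκ : 0 < κ) (α : ℝ) : Summable fun j => outEnvelope κ α j ^ 2 := by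
  simp_rw [outEnvelope_sq]
  exact summable_exp_int_sq (by positivity) α

lemma tsum_outEnvelope_sq_le (hε : ε ≤ 1) (h : SmallTails ε Δ κ) (α : ℝ) :
    ∑' j, outEnvelope κ α j ^ 2 ≤ 3 / κ := by
  have hκ := h.2.1
  simp_rw [outEnvelope_sq]
  have h1 := (abs_le.1 (abs_tsum_exp_sub_le (τ := κ ^ 2 / 2) (by positivity) α)).2
  have h2 : gaussTail (Real.pi / (κ ^ 2 / 2)) ≤ 1 := by
    refine (h.tail_right ?_).trans hε
    rw [div_div]
    gcongr
    nlinarith [sq_nonneg κ]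
  have h3 : 1 / √(κ ^ 2 / 2) = √2 / κ := by
    rw [Real.sqrt_div (by positivity), Real.sqrt_sq hκ.le, one_div_div]
  rw [h3] at h1
  have h4 : √2 / κ * gaussTail (Real.pi / (κ ^ 2 / 2)) ≤ √2 / κ * 1 :=
    mul_le_mul_of_nonneg_left h2 (by positivity)
  have h5 : 2 * (√2 / κ) ≤ 3 / κ := by
    rw [← mul_div_assoc]
    gcongr
    nlinarith [Real.sq_sqrt (show (0 : ℝ) ≤ 2 by norm_num), Real.sqrt_nonneg 2]
  linarith

/-- The wavefunction of the circuit for a fixed measurement result, up to normalization. -/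
noncomputable def rawOutput (a₀ a₁ : ℂ) (Δ κ α u xm x : ℝ) : ℂ :=
  qubit a₀ a₁ Δ κ α (x + xm / √2 - u) * qubit 1 1 Δ κ 0 (-x + xm / √2)

/-- As functions of $x$, the two peaks have centers $\sqrt\pi\,(n+m-t)$ apart, with midpoint $\frac
u2+(n-m+\alpha)\frac{\sqrt\pi}2$. So `t` enters only through the weight of the index sum. -/
lemma rawOutput_eq_tsum (a₀ a₁ : ℂ) (hΔ : 0 < Δ) (hκ : 0 < κ) {α u xm t : ℝ}
    (ht : √Real.pi * t = √2 * xm - u - α * √Real.pi) (x : ℝ) :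
    rawOutput a₀ a₁ Δ κ α u xm x =
      ∑' p, pairTerm (√Real.pi / 2) (Δ / √2) α (qubitAmp a₀ a₁ Δ κ α) (qubitAmp 1 1 Δ κ 0)
        (outEnvelope κ α) (peakWeight Δ κ α t) (x - u / 2) p := by
  unfold rawOutput
  rw [qubit_eq_latticeComb a₀ a₁ Δ hκ, qubit_eq_latticeComb 1 1 Δ hκ]
  unfold latticeComb
  rw [tsum_mul_tsum_of_summable_norm
    (summable_latticeComb (summable_qubitCoeff a₀ a₁ Δ hκ α) _)
    (summable_latticeComb (summable_qubitCoeff 1 1 Δ hκ 0) _)]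
  refine tsum_congr fun ⟨n, m⟩ => ?_
  simp only [qubitCoeff, pairTerm]
  have h2 : √2 * √2 = 2 := Real.mul_self_sqrt (by norm_num)
  have hv : √2 * xm = 2 * (xm / √2) := by
    field_simp
    linear_combination xm * h2
  have hpi : √Real.pi ^ 2 = Real.pi := Real.sq_sqrt Real.pi_pos.le
  have key : gauss (1 / κ) ((n + α) * √Real.pi) * gauss (1 / κ) ((m + 0) * √Real.pi) *
      (gauss Δ (x + xm / √2 - u - (n + α) * √Real.pi) *
        gauss Δ (-x + xm / √2 - (m + 0) * √Real.pi)) =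
      peakWeight Δ κ α t (n + m) * outEnvelope κ α (n - m) *
        gauss (Δ / √2) (x - u / 2 - (((n - m : ℤ) : ℝ) + α) * (√Real.pi / 2)) := by
    rw [← gauss_neg Δ (-x + xm / √2 - (m + 0) * √Real.pi),
      show x + xm / √2 - u - (n + α) * √Real.pi = x - (u - xm / √2 + (n + α) * √Real.pi) by ring,
      show -(-x + xm / √2 - (m + 0) * √Real.pi) = x - (xm / √2 - m * √Real.pi) by ring,
      gauss_mul_gauss hΔ.ne', gauss_inv_eq, gauss_inv_eq]
    unfold peakWeight outEnvelope
    rw [show (u - xm / √2 + (n + α) * √Real.pi) - (xm / √2 - m * √Real.pi) =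
      √Real.pi * (n + m - t) by linear_combination ht + hv]
    rw [← mul_assoc]
    congr 1
    · rw [← Real.exp_add, ← Real.exp_add, ← Real.exp_add, ← Real.exp_add, mul_pow, hpi]
      congr 1
      push_cast
      field_simp
      ring
    · congr 1
      push_cast
      ring
  have key' := congrArg (fun z : ℝ => (z : ℂ)) key
  simp only [Complex.ofReal_mul] at key'
  linear_combination (qubitAmp a₀ a₁ Δ κ α n * qubitAmp 1 1 Δ κ 0 m) * key'

lemma qubitAmp_sub_two_mul (a₀ a₁ : ℂ) (Δ κ α : ℝ) (n i : ℤ) :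
    qubitAmp a₀ a₁ Δ κ α (n - 2 * i) = qubitAmp a₀ a₁ Δ κ α n := by
  have : Even (n - 2 * i) ↔ Even n := by simp [Int.even_sub]
  simp only [qubitAmp, this]

/-- The predicted output on the lattice of the actual output. -/
lemma qubit_prediction_eq (a₀ a₁ : ℂ) (Δ : ℝ) (hκ : 0 < κ) (α : ℝ) (k₀ : ℤ) (y : ℝ) :
    qubit a₀ a₁ (Δ / √2) (κ * √2) (α / 2 - ((k₀ % 4 : ℤ) : ℝ) / 2) y =
      ∑' n : ℤ, qubitAmp a₀ a₁ (Δ / √2) (κ * √2) (α / 2 - ((k₀ % 4 : ℤ) : ℝ) / 2) n *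
        (outEnvelope κ α (2 * n - k₀) : ℂ) *
        (gauss (Δ / √2) (y - ((2 * (n : ℝ) - k₀) + α) * (√Real.pi / 2)) : ℂ) := by
  rw [qubit_eq_latticeComb a₀ a₁ (Δ / √2) (by positivity : 0 < κ * √2)]
  unfold latticeComb
  set β := α / 2 - ((k₀ % 4 : ℤ) : ℝ) / 2 with hβ
  -- Shifting by $2\lfloor k_0/4\rfloor$ turns the remainder modulo 4 back into $k_0$; the shift is
  -- even, so the amplitudes do not change.
  rw [← (Equiv.subRight (2 * (k₀ / 4))).tsum_eq]
  refine tsum_congr fun n => ?_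
  have hk : (k₀ : ℝ) = 4 * ((k₀ / 4 : ℤ) : ℝ) + ((k₀ % 4 : ℤ) : ℝ) := by
    exact_mod_cast (Int.mul_ediv_add_emod k₀ 4).symm
  have h1 : (((Equiv.subRight (2 * (k₀ / 4))) n : ℤ) : ℝ) + β = (2 * n - k₀ + α) / 2 := by
    simp only [Equiv.subRight_apply]
    push_cast
    rw [hβ, hk]
    ring
  rw [qubitCoeff, h1, Equiv.subRight_apply, qubitAmp_sub_two_mul, gauss_inv_eq]
  have h2 : Real.exp (-(Real.pi * (κ * √2) ^ 2 / 2) * ((2 * n - k₀ + α) / 2) ^ 2) =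
      outEnvelope κ α (2 * n - k₀) := by
    unfold outEnvelope
    rw [mul_pow, Real.sq_sqrt (by norm_num)]
    congr 1
    push_cast
    ring
  rw [h2, div_mul_eq_mul_div, mul_div_assoc]

/-- Both terms are close to $a\nu^2$ with $a$ the logical amplitude, because $m$ only selects one of
two almost equal constants: the auxiliary state carries no logical information. Four errors of size
$\theta\nu^2$ add up. -/
lemma norm_qubitAmp_mul_sub_le {ν ν' θ A : ℝ} (a₀ a₁ : ℂ) {Δ' κ' α β : ℝ} (hν : 0 < ν)
    (hν' : 0 < ν') (hθ : θ ≤ 1) (h : ∀ μ, |combNorm Δ κ μ - ν| ≤ θ * ν)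
    (h' : ∀ μ, |combNorm Δ' κ' μ - ν'| ≤ θ * ν') (h0 : ‖a₀‖ ≤ A) (h1 : ‖a₁‖ ≤ A) (n m : ℤ) :
    ‖qubitAmp a₀ a₁ Δ κ α n * qubitAmp 1 1 Δ κ 0 m -
      (ν ^ 2 / ν' : ℝ) * qubitAmp a₀ a₁ Δ' κ' β n‖ ≤ A * (4 * θ * ν ^ 2) := by
  have hθ0 : 0 ≤ θ := by
    have := (abs_nonneg _).trans (h 0)
    exact nonneg_of_mul_nonneg_left this hν
  have key : ∀ μ μ' μ'', |combNorm Δ κ μ * combNorm Δ κ μ' -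
      ν ^ 2 / ν' * combNorm Δ' κ' μ''| ≤ 4 * θ * ν ^ 2 := by
    intro μ μ' μ''
    have e : combNorm Δ κ μ * combNorm Δ κ μ' - ν ^ 2 / ν' * combNorm Δ' κ' μ'' =
        (combNorm Δ κ μ - ν) * (combNorm Δ κ μ' - ν) + ν * (combNorm Δ κ μ - ν) +
        ν * (combNorm Δ κ μ' - ν) - ν ^ 2 / ν' * (combNorm Δ' κ' μ'' - ν') := by
      field_simp
      ring
    rw [e]
    have b1 : |(combNorm Δ κ μ - ν) * (combNorm Δ κ μ' - ν)| ≤ θ * ν ^ 2 := by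
      rw [abs_mul]
      calc _ ≤ (θ * ν) * (θ * ν) := mul_le_mul (h _) (h _) (abs_nonneg _) (by positivity)
        _ = θ * (θ * ν ^ 2) := by ring
        _ ≤ 1 * (θ * ν ^ 2) := by gcongr
        _ = _ := one_mul _
    have b2 : ∀ μ, |ν * (combNorm Δ κ μ - ν)| ≤ θ * ν ^ 2 := by
      intro μ
      rw [abs_mul, abs_of_pos hν]
      calc _ ≤ ν * (θ * ν) := mul_le_mul_of_nonneg_left (h _) hν.le
        _ = _ := by ring
    have b3 : |ν ^ 2 / ν' * (combNorm Δ' κ' μ'' - ν')| ≤ θ * ν ^ 2 := by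
      rw [abs_mul, abs_of_pos (by positivity)]
      calc _ ≤ ν ^ 2 / ν' * (θ * ν') := mul_le_mul_of_nonneg_left (h' _) (by positivity)
        _ = _ := by field_simp
    have := abs_sub (((combNorm Δ κ μ - ν) * (combNorm Δ κ μ' - ν) + ν * (combNorm Δ κ μ - ν)) +
        ν * (combNorm Δ κ μ' - ν)) (ν ^ 2 / ν' * (combNorm Δ' κ' μ'' - ν'))
    have := abs_add_le ((combNorm Δ κ μ - ν) * (combNorm Δ κ μ' - ν) + ν * (combNorm Δ κ μ - ν))
        (ν * (combNorm Δ κ μ' - ν))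
    have := abs_add_le ((combNorm Δ κ μ - ν) * (combNorm Δ κ μ' - ν)) (ν * (combNorm Δ κ μ - ν))
    have := b2 μ
    have := b2 μ'
    linarith
  obtain ⟨μ', hm⟩ : ∃ μ', qubitAmp 1 1 Δ κ 0 m = combNorm Δ κ μ' := by
    unfold qubitAmp
    split_ifs
    · exact ⟨_, one_mul _⟩
    · exact ⟨_, one_mul _⟩
  obtain ⟨a, μ, μ'', ha, hn, hn'⟩ : ∃ (a : ℂ) (μ μ'' : ℝ), ‖a‖ ≤ A ∧
      qubitAmp a₀ a₁ Δ κ α n = a * combNorm Δ κ μ ∧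
      qubitAmp a₀ a₁ Δ' κ' β n = a * combNorm Δ' κ' μ'' := by
    unfold qubitAmp
    split_ifs
    · exact ⟨a₀, _, _, h0, rfl, rfl⟩
    · exact ⟨a₁, _, _, h1, rfl, rfl⟩
  rw [hm, hn, hn', show a * combNorm Δ κ μ * combNorm Δ κ μ' -
    (ν ^ 2 / ν' : ℝ) * (a * combNorm Δ' κ' μ'') =
    a * ((combNorm Δ κ μ * combNorm Δ κ μ' - ν ^ 2 / ν' * combNorm Δ' κ' μ'' : ℝ) : ℂ) by
    push_cast; ring, norm_mul, Complex.norm_real, Real.norm_eq_abs]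
  exact mul_le_mul ha (key _ _ _) (abs_nonneg _) ((norm_nonneg _).trans ha)

end

/-! ### $L^2$ distance between the output and the prediction. -/

section
variable {ε Δ κ : ℝ}

lemma asympNorm_pow_four (h : SmallTails ε Δ κ) :
    asympNorm Δ κ ^ 4 = 4 * κ ^ 2 / (Real.pi * Δ ^ 2) := by
  have hΔ := h.1
  have hκ := h.2.1
  unfold asympNorm
  rw [show 4 = 2 * 2 from rfl, pow_mul, Real.sq_sqrt (by positivity), div_pow, mul_pow, mul_pow,
    Real.sq_sqrt Real.pi_pos.le]
  norm_num

lemma norm_qubitAmp_le_mul (hε0 : 0 ≤ ε) (hε : ε ≤ 1 / 2) (h : SmallTails ε Δ κ) {a₀ a₁ : ℂ} {A : ℝ}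
    (h0 : ‖a₀‖ ≤ A) (h1 : ‖a₁‖ ≤ A) (α : ℝ) (n : ℤ) :
    ‖qubitAmp a₀ a₁ Δ κ α n‖ ≤ A * (2 * asympNorm Δ κ) := by
  have hν := asympNorm_pos h
  have hN : ∀ μ, ‖(combNorm Δ κ μ : ℂ)‖ ≤ 2 * asympNorm Δ κ := by
    intro μ
    have := (abs_le.1 (abs_combNorm_sub_le hε0 hε h μ)).2
    rw [Complex.norm_real, Real.norm_eq_abs, abs_of_pos (combNorm_pos (by linarith) h μ)]
    nlinarith
  have hA : 0 ≤ A := (norm_nonneg _).trans h0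
  unfold qubitAmp
  split_ifs
  · rw [norm_mul]; exact mul_le_mul h0 (hN _) (norm_nonneg _) hA
  · rw [norm_mul]; exact mul_le_mul h1 (hN _) (norm_nonneg _) hA

/-- Spacing $\sqrt\pi/2$ with width $\Delta/\sqrt2$ gives exactly the exponent $\pi/(8\Delta^2)$
that appears in `SmallTails`. -/
lemma gaussTail_half_lattice_le (hε : ε ≤ 1) (h : SmallTails ε Δ κ) :
    gaussTail ((√Real.pi / 2) ^ 2 / (4 * (Δ / √2) ^ 2)) ≤ 1 := by
  refine (h.tail_left (le_of_eq ?_)).trans hε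
  have hΔ := h.1
  rw [div_pow, div_pow, Real.sq_sqrt Real.pi_pos.le, Real.sq_sqrt (by norm_num)]
  field_simp
  norm_num

lemma gaussTail_lattice_le (hε : ε ≤ 1) (h : SmallTails ε Δ κ) :
    gaussTail (√Real.pi ^ 2 / (4 * (Δ / √2) ^ 2)) ≤ 1 := by
  have hΔ := h.1
  refine le_trans (gaussTail_anti (by positivity) ?_) (gaussTail_half_lattice_le hε h)
  gcongr
  linarith [Real.sqrt_nonneg Real.pi]

/-- Scaling: $\nu^4\sim\kappa^2/\Delta^2$, a peak has mass of order $\Delta$ and about $1/\kappa$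
peaks count, which leaves the common factor $\kappa/\Delta$ of all the $L^2$ estimates. -/
lemma two_mul_gauss_mass_mul_le (h : SmallTails ε Δ κ) {X C : ℝ} (hX : 0 ≤ X) {S : ℝ} (hC : 0 ≤ C)
    (hS : S ≤ 3 / κ) :
    2 * (Δ / √2 * √Real.pi * (C * X * asympNorm Δ κ ^ 4 * S)) ≤ 12 * C * (X * (κ / Δ)) := by
  have hΔ := h.1
  have hκ := h.2.1
  rw [asympNorm_pow_four h]
  have h2 : 2 ≤ √2 * √Real.pi := by
    rw [← Real.sqrt_mul (by norm_num)]
    exact Real.le_sqrt_of_sq_le (by linarith [Real.pi_gt_three])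
  have hpi : √Real.pi * √Real.pi = Real.pi := Real.mul_self_sqrt Real.pi_pos.le
  calc _ ≤ 2 * (Δ / √2 * √Real.pi * (C * X * (4 * κ ^ 2 / (Real.pi * Δ ^ 2)) * (3 / κ))) := by
        gcongr
    _ = 24 * C * (X * (κ / Δ)) / (√2 * √Real.pi) := by
        nth_rewrite 2 [← hpi]
        field_simp
        ring
    _ ≤ 24 * C * (X * (κ / Δ)) / 2 := by gcongr
    _ = _ := by ring

variable {a₀ a₁ : ℂ} {A : ℝ}

/-- `L²` bound for a sum of products of peaks with given weights. -/
lemma integral_norm_sq_tsum_pairTerm_le (hε0 : 0 ≤ ε) (hε : ε ≤ 1 / 2) (h : SmallTails ε Δ κ)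
    (h0 : ‖a₀‖ ≤ A) (h1 : ‖a₁‖ ≤ A) (α s : ℝ) {τ : ℤ → ℝ} (hτ : Summable τ) (hτ0 : ∀ k, 0 ≤ τ k) :
    let F : ℝ → ℂ := fun x => ∑' p, pairTerm (√Real.pi / 2) (Δ / √2) α (qubitAmp a₀ a₁ Δ κ α)
      (qubitAmp 1 1 Δ κ 0) (outEnvelope κ α) τ (x - s) p
    Continuous F ∧ Integrable (fun x => ‖F x‖ ^ 2) ∧
      ∫ x, ‖F x‖ ^ 2 ≤ 200 * (A ^ 2 * (κ / Δ) * (∑' k, τ k) ^ 2) := by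
  intro F
  have hΔ := h.1
  have hκ := h.2.1
  have hγ := norm_qubitAmp_le_mul hε0 hε h h0 h1 α
  have hδ := norm_qubitAmp_le_mul hε0 hε h (A := 1) (a₀ := 1) (a₁ := 1) (by simp) (by simp) 0
  have he := summable_outEnvelope hκ α
  have he0 := fun j => (outEnvelope_pos κ α j).le
  have hs := summable_norm_pairCoeff hγ hδ he he0 hτ hτ0
  have hF : F = fun x => latticeComb (√Real.pi / 2) (Δ / √2) α (pairCoeff (qubitAmp a₀ a₁ Δ κ α)
      (qubitAmp 1 1 Δ κ 0) (outEnvelope κ α) τ) (x - s) := by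
    ext x
    exact tsum_pairTerm_eq_latticeComb hγ hδ he he0 hτ hτ0 (x - s)
  rw [hF]
  refine ⟨(continuous_latticeComb hs).comp (by fun_prop),
    (integrable_norm_sq_latticeComb (by positivity) hs).comp_sub_right s, ?_⟩
  rw [integral_sub_right_eq_self fun x => ‖latticeComb (√Real.pi / 2) (Δ / √2) α
    (pairCoeff (qubitAmp a₀ a₁ Δ κ α) (qubitAmp 1 1 Δ κ 0) (outEnvelope κ α) τ) x‖ ^ 2]
  refine (integral_norm_sq_latticeComb_le_of_le (by positivity) (by positivity)
    (gaussTail_half_lattice_le (by linarith) h) he (summable_outEnvelope_sq hκ α)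
    (norm_pairCoeff_le hγ hδ he0 hτ hτ0)).trans ?_
  -- $16=(2\cdot2)^2$, from the bounds $2\nu$ on each of the two constants.
  have hb := two_mul_gauss_mass_mul_le h (X := A ^ 2 * (∑' k, τ k) ^ 2) (C := 16)
    (by positivity) (by norm_num) (tsum_outEnvelope_sq_le (by linarith) h α)
  have hpos : 0 ≤ A ^ 2 * (κ / Δ) * (∑' k, τ k) ^ 2 := by positivity
  calc _ = 2 * (Δ / √2 * √Real.pi * (16 * (A ^ 2 * (∑' k, τ k) ^ 2) * asympNorm Δ κ ^ 4 *
        ∑' j, outEnvelope κ α j ^ 2)) := by ring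
    _ ≤ _ := hb
    _ = 192 * (A ^ 2 * (κ / Δ) * (∑' k, τ k) ^ 2) := by ring
    _ ≤ _ := by linarith

lemma rawOutput_bound (hε0 : 0 ≤ ε) (hε : ε ≤ 1 / 2) (h : SmallTails ε Δ κ)
    (h0 : ‖a₀‖ ≤ A) (h1 : ‖a₁‖ ≤ A) {α u xm t : ℝ}
    (ht : √Real.pi * t = √2 * xm - u - α * √Real.pi) :
    Continuous (rawOutput a₀ a₁ Δ κ α u xm) ∧
      Integrable (fun x => ‖rawOutput a₀ a₁ Δ κ α u xm x‖ ^ 2) ∧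
      ∫ x, ‖rawOutput a₀ a₁ Δ κ α u xm x‖ ^ 2 ≤
        200 * (A ^ 2 * (κ / Δ) * (∑' k, peakWeight Δ κ α t k) ^ 2) := by
  have hr := integral_norm_sq_tsum_pairTerm_le hε0 hε h h0 h1 α (u / 2)
    (summable_peakWeight Δ h.2.1 α t) fun k => (peakWeight_pos _ _ _ _ k).le
  rw [show rawOutput a₀ a₁ Δ κ α u xm = _ from funext (rawOutput_eq_tsum a₀ a₁ h.1 h.2.1 ht)]
  exact hr

/-- The total weight of the peaks whose index sum is not `k₀`. -/
noncomputable def otherWeight (Δ κ α t : ℝ) (k₀ : ℤ) : ℝ :=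
  ∑' k, if k = k₀ then 0 else peakWeight Δ κ α t k

lemma summable_otherWeight (Δ : ℝ) (hκ : 0 < κ) (α t : ℝ) (k₀ : ℤ) :
    Summable fun k => if k = k₀ then 0 else peakWeight Δ κ α t k := by
  refine Summable.of_nonneg_of_le (fun k => ?_) (fun k => ?_) (summable_peakWeight Δ hκ α t)
  · split_ifs
    · exact le_rfl
    · exact (peakWeight_pos _ _ _ _ k).le
  · split_ifs
    · exact (peakWeight_pos _ _ _ _ k).le
    · exact le_rfl

lemma norm_add_sq_le_two_mul {E : Type*} [SeminormedAddCommGroup E] (a b : E) :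
    ‖a + b‖ ^ 2 ≤ 2 * ‖a‖ ^ 2 + 2 * ‖b‖ ^ 2 := by
  have h := norm_add_le a b
  have := pow_le_pow_left₀ (norm_nonneg _) h 2
  nlinarith [sq_nonneg (‖a‖ - ‖b‖)]

/-- The output is close to a multiple of the predicted qubit. -/
lemma exists_rawOutput_approx (hε0 : 0 ≤ ε) (hε : ε ≤ 1 / 3) (h : SmallTails ε Δ κ)
    (h' : SmallTails ε (Δ / √2) (κ * √2)) (hA : A ^ 2 = ‖a₀‖ ^ 2 + ‖a₁‖ ^ 2) (hA0 : 0 ≤ A)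
    {α u xm t : ℝ} (ht : √Real.pi * t = √2 * xm - u - α * √Real.pi) (k₀ : ℤ) :
    ∃ l : ℝ, ∫ x, ‖rawOutput a₀ a₁ Δ κ α u xm x - (l : ℂ) * qubit a₀ a₁ (Δ / √2) (κ * √2)
        (α / 2 - ((k₀ % 4 : ℤ) : ℝ) / 2) (x - u / 2)‖ ^ 2 ≤
        2000 * (A ^ 2 * (κ / Δ) *
          (ε ^ 2 * peakWeight Δ κ α t k₀ ^ 2 + otherWeight Δ κ α t k₀ ^ 2)) ∧
      A ^ 2 * (κ / Δ) * peakWeight Δ κ α t k₀ ^ 2 / 4 ≤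
        l ^ 2 * ∫ x, ‖qubit a₀ a₁ (Δ / √2) (κ * √2)
          (α / 2 - ((k₀ % 4 : ℤ) : ℝ) / 2) (x - u / 2)‖ ^ 2 := by
  have hΔ := h.1
  have hκ := h.2.1
  set β := α / 2 - ((k₀ % 4 : ℤ) : ℝ) / 2 with hβ
  set ν := asympNorm Δ κ with hνd
  set ν' := asympNorm (Δ / √2) (κ * √2) with hνd'
  have hν : 0 < ν := asympNorm_pos h
  have hν' : 0 < ν' := asympNorm_pos h'
  set w := peakWeight Δ κ α t k₀ with hw
  have hw0 : 0 < w := peakWeight_pos _ _ _ _ _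
  have h0 : ‖a₀‖ ≤ A := by
    refine (pow_le_pow_iff_left₀ (norm_nonneg _) hA0 two_ne_zero).1 ?_
    rw [hA]; nlinarith [sq_nonneg ‖a₁‖]
  have h1 : ‖a₁‖ ≤ A := by
    refine (pow_le_pow_iff_left₀ (norm_nonneg _) hA0 two_ne_zero).1 ?_
    rw [hA]; nlinarith [sq_nonneg ‖a₀‖]
  set γ := qubitAmp a₀ a₁ Δ κ α with hγd
  set δ := qubitAmp 1 1 Δ κ 0 with hδd
  set γ' := qubitAmp a₀ a₁ (Δ / √2) (κ * √2) β with hγd'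
  have hγ := norm_qubitAmp_le_mul hε0 (by linarith) h h0 h1 α
  have hδ := norm_qubitAmp_le_mul hε0 (by linarith) h (A := 1) (a₀ := 1) (a₁ := 1)
    (by simp) (by simp) 0
  have he := summable_outEnvelope hκ α
  have he0 := fun j => (outEnvelope_pos κ α j).le
  have hτ0 := fun k => (peakWeight_pos Δ κ α t k).le
  -- Coefficients of the part with index sum $k_0$ minus those of the rescaled prediction; only the
  -- errors of the normalization constants survive.
  set b : ℤ → ℂ := fun n => (γ n * δ (k₀ - n) - (ν ^ 2 / ν' : ℝ) * γ' n) * (w : ℂ) *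
    (outEnvelope κ α (2 * n - k₀) : ℂ) with hb
  have hinj : Function.Injective fun n : ℤ => 2 * n - k₀ := fun a b h => by simpa using h
  have hbn : ∀ n, ‖b n‖ ≤ A * (4 * (2 * ε) * ν ^ 2) * w * outEnvelope κ α (2 * n - k₀) := by
    intro n
    rw [hb]
    simp only
    rw [norm_mul, norm_mul, Complex.norm_real, Complex.norm_real, Real.norm_eq_abs,
      Real.norm_eq_abs, abs_of_pos hw0, abs_of_pos (outEnvelope_pos _ _ _)]
    refine mul_le_mul_of_nonneg_right (mul_le_mul_of_nonneg_right ?_ hw0.le) (he0 _)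
    exact norm_qubitAmp_mul_sub_le a₀ a₁ hν hν' (by linarith)
      (abs_combNorm_sub_le hε0 (by linarith) h) (abs_combNorm_sub_le hε0 (by linarith) h') h0 h1 _ _
  have he' : Summable fun n : ℤ => outEnvelope κ α (2 * n - k₀) := he.comp_injective hinj
  have he2' : Summable fun n : ℤ => outEnvelope κ α (2 * n - k₀) ^ 2 :=
    (summable_outEnvelope_sq hκ α).comp_injective hinj
  have hbs : Summable fun n => ‖b n‖ :=
    Summable.of_nonneg_of_le (fun _ => norm_nonneg _) hbn (he'.mul_left _)
  set G : ℝ → ℂ := fun x => latticeComb √Real.pi (Δ / √2) ((α - k₀) / 2) b (x - u / 2) with hG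
  have hr := integral_norm_sq_tsum_pairTerm_le hε0 (by linarith) h h0 h1 α (u / 2)
    (summable_otherWeight Δ hκ α t k₀) fun k => by
      split_ifs
      · exact le_rfl
      · exact hτ0 k
  set H : ℝ → ℂ := fun x => ∑' p, pairTerm (√Real.pi / 2) (Δ / √2) α γ δ (outEnvelope κ α)
    (fun k => if k = k₀ then 0 else peakWeight Δ κ α t k) (x - u / 2) p with hH
  have hsplit : ∀ x, rawOutput a₀ a₁ Δ κ α u xm x -
      ((w * (ν ^ 2 / ν') : ℝ) : ℂ) * qubit a₀ a₁ (Δ / √2) (κ * √2) β (x - u / 2) = G x + H x := by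
    intro x
    rw [rawOutput_eq_tsum a₀ a₁ hΔ hκ ht, tsum_pairTerm_split hγ hδ he he0
      (summable_peakWeight Δ hκ α t) hτ0 _ k₀, add_sub_right_comm]
    congr 1
    rw [hβ, qubit_prediction_eq a₀ a₁ Δ hκ α k₀, ← hβ, ← tsum_mul_left, hG]
    simp only [latticeComb]
    rw [← Summable.tsum_sub]
    · refine tsum_congr fun n => ?_
      rw [hb]
      simp only
      rw [show ((n : ℝ) + (α - k₀) / 2) * √Real.pi = (2 * n - k₀ + α) * (√Real.pi / 2) by ring]
      push_cast
      ring
    · have hle : ∀ n : ℤ, ‖γ n * δ (k₀ - n) * (w : ℂ) * (outEnvelope κ α (2 * n - k₀) : ℂ)‖ ≤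
          A * (2 * ν) * (1 * (2 * ν)) * w * outEnvelope κ α (2 * n - k₀) := by
        intro n
        rw [norm_mul, norm_mul, norm_mul, Complex.norm_real, Complex.norm_real, Real.norm_eq_abs,
          Real.norm_eq_abs, abs_of_pos hw0, abs_of_pos (outEnvelope_pos _ _ _)]
        refine mul_le_mul_of_nonneg_right (mul_le_mul_of_nonneg_right ?_ hw0.le) (he0 _)
        exact mul_le_mul (hγ _) (hδ _) (norm_nonneg _) (by positivity)
      refine Summable.of_norm (Summable.of_nonneg_of_le (fun _ => norm_nonneg _)
        (fun n => (norm_mul_gauss_le _ _ _).trans (hle n)) (he'.mul_left _))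
    · refine Summable.mul_left _ (Summable.of_norm (Summable.of_nonneg_of_le
        (fun _ => norm_nonneg _) (fun n => (norm_mul_gauss_le _ _ _).trans ?_)
        (he'.mul_left (A * (2 * ν')))))
      rw [norm_mul, Complex.norm_real, Real.norm_eq_abs, abs_of_pos (outEnvelope_pos _ _ _)]
      exact mul_le_mul_of_nonneg_right
        (norm_qubitAmp_le_mul hε0 (by linarith) h' h0 h1 _ _) (he0 _)
  -- The output carries two constants $\approx\nu$ and the weight $w$, the prediction one constant
  -- $\approx\nu'$; their ratio is the multiple.
  refine ⟨w * (ν ^ 2 / ν'), ?_, ?_⟩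
  · simp_rw [hsplit]
    have hGi : Integrable fun x => ‖G x‖ ^ 2 :=
      (integrable_norm_sq_latticeComb (by positivity) hbs).comp_sub_right (u / 2)
    have hGb : ∫ x, ‖G x‖ ^ 2 ≤ 768 * (A ^ 2 * (κ / Δ) * (ε ^ 2 * w ^ 2)) := by
      rw [hG, integral_sub_right_eq_self fun x =>
        ‖latticeComb √Real.pi (Δ / √2) ((α - k₀) / 2) b x‖ ^ 2]
      refine (integral_norm_sq_latticeComb_le_of_le (by positivity) (by positivity)
        (gaussTail_lattice_le (by linarith) h) he' he2' hbn).trans ?_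
      have hS : ∑' n : ℤ, outEnvelope κ α (2 * n - k₀) ^ 2 ≤ 3 / κ :=
        (tsum_comp_le_tsum_of_inj (summable_outEnvelope_sq hκ α) (fun _ => by positivity)
          hinj).trans (tsum_outEnvelope_sq_le (by linarith) h α)
      have hb := two_mul_gauss_mass_mul_le h (X := A ^ 2 * (ε ^ 2 * w ^ 2)) (C := 64)
        (by positivity) (by norm_num) hS
      calc _ = 2 * (Δ / √2 * √Real.pi * (64 * (A ^ 2 * (ε ^ 2 * w ^ 2)) * ν ^ 4 *
            ∑' n : ℤ, outEnvelope κ α (2 * n - k₀) ^ 2)) := by ring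
        _ ≤ _ := hb
        _ = _ := by ring
    have hpos : 0 ≤ A ^ 2 * (κ / Δ) * (ε ^ 2 * w ^ 2) := by positivity
    calc _ ≤ ∫ x, (2 * ‖G x‖ ^ 2 + 2 * ‖H x‖ ^ 2) :=
          integral_mono_of_nonneg (ae_of_all _ fun x => by positivity)
            ((hGi.const_mul 2).add (hr.2.1.const_mul 2))
            (ae_of_all _ fun x => norm_add_sq_le_two_mul _ _)
      _ = 2 * (∫ x, ‖G x‖ ^ 2) + 2 * ∫ x, ‖H x‖ ^ 2 := by
          rw [integral_add (hGi.const_mul 2) (hr.2.1.const_mul 2), integral_const_mul,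
            integral_const_mul]
      _ ≤ 2 * (768 * (A ^ 2 * (κ / Δ) * (ε ^ 2 * w ^ 2))) +
          2 * (200 * (A ^ 2 * (κ / Δ) * otherWeight Δ κ α t k₀ ^ 2)) := by
          gcongr
          exact hr.2.2
      _ ≤ _ := by
          have : 0 ≤ A ^ 2 * (κ / Δ) * otherWeight Δ κ α t k₀ ^ 2 := by positivity
          nlinarith
  · rw [integral_sub_right_eq_self fun x => ‖qubit a₀ a₁ (Δ / √2) (κ * √2) β x‖ ^ 2]
    have hq := le_integral_norm_sq_qubit hε0 hε h' a₀ a₁ β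
    rw [← hA] at hq
    have hν4 : ν ^ 4 = 4 * κ ^ 2 / (Real.pi * Δ ^ 2) := asympNorm_pow_four h
    have hν2 : ν' ^ 2 = 4 * κ / (√Real.pi * Δ) := by
      rw [hνd']
      unfold asympNorm
      rw [Real.sq_sqrt (by positivity)]
      have h2 : √2 ^ 2 = 2 := Real.sq_sqrt (by norm_num)
      field_simp
      rw [h2]
      norm_num
    have hl : (w * (ν ^ 2 / ν')) ^ 2 = w ^ 2 * (κ / Δ) / √Real.pi := by
      rw [mul_pow, div_pow, ← pow_mul, hν4, hν2]
      have hpi : √Real.pi * √Real.pi = Real.pi := Real.mul_self_sqrt Real.pi_pos.le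
      nth_rewrite 1 [← hpi]
      field_simp
    have hpi2 : √Real.pi ≤ 2 := by
      rw [Real.sqrt_le_left (by norm_num)]
      linarith [Real.pi_lt_four]
    rw [hl]
    calc _ = w ^ 2 * (κ / Δ) / 2 * (A ^ 2 / 2) := by ring
      _ ≤ _ := by gcongr

end

/-! ### Fidelity and $L^2$ distance. -/

/-- The left side is $\|g\|^2$ times the squared distance from $f$ to the line spanned by $g$, and
$l\,g$ is one point of that line. -/
lemma norm_sq_mul_sub_inner_le {E : Type*} [NormedAddCommGroup E] [InnerProductSpace ℂ E]
    (f g : E) (l : ℂ) : ‖f‖ ^ 2 * ‖g‖ ^ 2 - ‖inner ℂ f g‖ ^ 2 ≤ ‖f - l • g‖ ^ 2 * ‖g‖ ^ 2 := by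
  rw [norm_sub_sq (𝕜 := ℂ), inner_smul_right, norm_smul]
  have h := Complex.re_le_norm (l * inner ℂ f g)
  rw [norm_mul] at h
  simp only [RCLike.re_to_complex]
  nlinarith [sq_nonneg (‖l‖ * ‖g‖ ^ 2 - ‖inner ℂ f g‖), mul_le_mul_of_nonneg_right h
    (sq_nonneg ‖g‖)]

lemma inner_toLp {f g : ℝ → ℂ} (hf : MemLp f 2) (hg : MemLp g 2) :
    inner ℂ (hf.toLp f) (hg.toLp g) = ∫ x, (starRingEnd ℂ) (f x) * g x := by
  rw [L2.inner_def]
  refine integral_congr_ae ?_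
  filter_upwards [hf.coeFn_toLp, hg.coeFn_toLp] with x h1 h2
  rw [h1, h2, RCLike.inner_apply, mul_comm]

lemma norm_toLp_sq {f : ℝ → ℂ} (hf : MemLp f 2) : ‖hf.toLp f‖ ^ 2 = ∫ x, ‖f x‖ ^ 2 := by
  have h := inner_toLp hf hf
  rw [inner_self_eq_norm_sq_to_K] at h
  have h2 : ∀ x, (starRingEnd ℂ) (f x) * f x = ((‖f x‖ ^ 2 : ℝ) : ℂ) := fun x => by
    rw [mul_comm, Complex.mul_conj, Complex.normSq_eq_norm_sq]
  simp_rw [h2] at h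
  rw [integral_complex_ofReal] at h
  exact Complex.ofReal_injective (by rw [← h]; simp)

lemma fidelity_nonneg (f g : ℝ → ℂ) : 0 ≤ fidelity f g := by
  unfold fidelity
  have h1 : 0 ≤ ∫ x, ‖f x‖ ^ 2 := integral_nonneg fun x => by positivity
  have h2 : 0 ≤ ∫ x, ‖g x‖ ^ 2 := integral_nonneg fun x => by positivity
  positivity

lemma fidelity_eq {f g : ℝ → ℂ} (hf : MemLp f 2) (hg : MemLp g 2) : fidelity f g =
    ‖inner ℂ (hf.toLp f) (hg.toLp g)‖ ^ 2 / (‖hf.toLp f‖ ^ 2 * ‖hg.toLp g‖ ^ 2) := by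
  rw [inner_toLp, norm_toLp_sq, norm_toLp_sq, fidelity]

lemma fidelity_le_one {f g : ℝ → ℂ} (hf : MemLp f 2) (hg : MemLp g 2) : fidelity f g ≤ 1 := by
  rw [fidelity_eq hf hg, ← mul_pow]
  exact div_le_one_of_le₀ (pow_le_pow_left₀ (norm_nonneg _) (norm_inner_le_norm _ _) 2)
    (by positivity)

/-- The infidelity is bounded by the distance to any multiple of the second wavefunction. -/
lemma one_sub_fidelity_mul_le {f g : ℝ → ℂ} (hf : MemLp f 2) (hg : MemLp g 2) (l : ℂ) :
    (1 - fidelity f g) * ∫ x, ‖f x‖ ^ 2 ≤ ∫ x, ‖f x - l * g x‖ ^ 2 := by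
  have h := norm_sq_mul_sub_inner_le (hf.toLp f) (hg.toLp g) l
  have hV : ∫ x, ‖f x - l * g x‖ ^ 2 = ‖hf.toLp f - l • hg.toLp g‖ ^ 2 := by
    rw [← MemLp.toLp_const_smul, ← MemLp.toLp_sub, norm_toLp_sq]
    rfl
  rw [hV, fidelity_eq hf hg, ← norm_toLp_sq hf]
  set F := hf.toLp f
  set G := hg.toLp g
  -- Degenerate states have fidelity 0 by division by zero. The claim survives: for $F=0$ its left
  -- side vanishes, for $G=0$ both sides are $\|F\|^2$.
  rcases eq_or_ne F 0 with hF | hF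
  · rw [hF]
    simp only [norm_zero]
    rw [zero_pow two_ne_zero, mul_zero]
    positivity
  rcases eq_or_ne G 0 with hG | hG
  · rw [hG]
    simp
  have hF0 : 0 < ‖F‖ := norm_pos_iff.2 hF
  have hG0 : 0 < ‖G‖ := norm_pos_iff.2 hG
  refine le_of_mul_le_mul_right (le_trans (le_of_eq ?_) h) (show 0 < ‖G‖ ^ 2 by positivity)
  field_simp

lemma fidelity_const_mul {c : ℂ} (hc : c ≠ 0) (f g : ℝ → ℂ) :
    fidelity (fun x => c * f x) g = fidelity f g := by
  unfold fidelity
  simp_rw [map_mul, norm_mul, mul_pow, mul_assoc, integral_const_mul]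
  rw [norm_mul, RCLike.norm_conj, mul_pow, mul_assoc]
  exact mul_div_mul_left _ _ (by simpa using hc)

/-! ### The circuit and its fidelity. -/

section
variable {ε Δ κ : ℝ} {a₀ a₁ : ℂ}

/-- The normalization constant of the two-mode wavefunction before the measurement. -/
noncomputable def circuitNorm (Δ κ : ℝ) : ℝ :=
  √(√2) * (√(∫ t : ℝ, (psi Δ κ 0 t + psi Δ κ 1 t) ^ 2))⁻¹

lemma qubit_one_one (Δ κ x : ℝ) : qubit 1 1 Δ κ 0 x = ((psi Δ κ 0 x + psi Δ κ 1 x : ℝ) : ℂ) := by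
  simp [qubit]

lemma circuitNorm_pos (hε0 : 0 ≤ ε) (hε : ε ≤ 1 / 3) (h : SmallTails ε Δ κ) :
    0 < circuitNorm Δ κ := by
  have h1 := le_integral_norm_sq_qubit hε0 hε h 1 1 0
  simp_rw [qubit_one_one, Complex.norm_real, Real.norm_eq_abs, sq_abs] at h1
  have h2 : 0 < ∫ t : ℝ, (psi Δ κ 0 t + psi Δ κ 1 t) ^ 2 := by
    refine lt_of_lt_of_le ?_ h1
    norm_num
  unfold circuitNorm
  positivity

lemma qSE_eq (a₀ a₁ : ℂ) (Δ κ α u x y : ℝ) :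
    qSE Δ κ (fun x => qubit a₀ a₁ Δ κ α (x - u)) x y =
      (circuitNorm Δ κ : ℂ) * rawOutput a₀ a₁ Δ κ α u y x := by
  unfold qSE squeezeTop beamSplitter rawOutput circuitNorm psiPlus
  have h2 : √2 * √2 = 2 := Real.mul_self_sqrt (by norm_num)
  have e : Real.pi / 2 / 2 = Real.pi / 4 := by ring
  have e1 : y * (√2 / 2) = y / √2 := by
    field_simp
    linear_combination y * h2
  rw [e, Real.cos_pi_div_four, Real.sin_pi_div_four, e1,
    show √2 * x * (√2 / 2) = x by linear_combination (x / 2) * h2,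
    show -(√2 * x) * (√2 / 2) = -x by linear_combination (-x / 2) * h2, qubit_one_one]
  push_cast
  ring

lemma memLp_qubit_comp_sub (a₀ a₁ : ℂ) (hΔ : 0 < Δ) (hκ : 0 < κ) (α s : ℝ) :
    MemLp (fun x => qubit a₀ a₁ Δ κ α (x - s)) 2 := by
  have hc : Continuous fun x => qubit a₀ a₁ Δ κ α (x - s) :=
    (continuous_qubit a₀ a₁ Δ hκ α).comp (continuous_id.sub continuous_const)
  rw [memLp_two_iff_integrable_sq_norm hc.aestronglyMeasurable]
  exact (integrable_norm_sq_qubit a₀ a₁ hΔ hκ α).comp_sub_right s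

/-- Amplitude of the input qubit. -/
lemma exists_amplitude (a₀ a₁ : ℂ) : ∃ A : ℝ, 0 ≤ A ∧ A ^ 2 = ‖a₀‖ ^ 2 + ‖a₁‖ ^ 2 ∧
    ‖a₀‖ ≤ A ∧ ‖a₁‖ ≤ A := by
  refine ⟨√(‖a₀‖ ^ 2 + ‖a₁‖ ^ 2), Real.sqrt_nonneg _, Real.sq_sqrt (by positivity), ?_, ?_⟩
  · exact Real.le_sqrt_of_sq_le (by linarith [sq_nonneg ‖a₁‖])
  · exact Real.le_sqrt_of_sq_le (by linarith [sq_nonneg ‖a₀‖])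

/-- The rescaled and shifted measurement result. -/
noncomputable def scaledResult (α u xm : ℝ) : ℝ :=
  (xm - α * √(Real.pi / 2) - u / √2) / √(Real.pi / 2)

lemma sqrt_pi_mul_scaledResult (α u xm : ℝ) :
    √Real.pi * scaledResult α u xm = √2 * xm - u - α * √Real.pi := by
  unfold scaledResult
  rw [Real.sqrt_div Real.pi_pos.le]
  field_simp
  ring

lemma memLp_rawOutput (hε0 : 0 ≤ ε) (hε : ε ≤ 1 / 2) (h : SmallTails ε Δ κ) (a₀ a₁ : ℂ)
    (α u xm : ℝ) : MemLp (rawOutput a₀ a₁ Δ κ α u xm) 2 := by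
  obtain ⟨A, -, -, h0, h1⟩ := exists_amplitude a₀ a₁
  have hr := rawOutput_bound hε0 hε h h0 h1 (sqrt_pi_mul_scaledResult α u xm)
  exact (memLp_two_iff_integrable_sq_norm hr.1.aestronglyMeasurable).2 hr.2.1

lemma integral_norm_sq_qSE (a₀ a₁ : ℂ) (Δ κ α u y : ℝ) :
    ∫ x, ‖qSE Δ κ (fun x => qubit a₀ a₁ Δ κ α (x - u)) x y‖ ^ 2 =
      circuitNorm Δ κ ^ 2 * ∫ x, ‖rawOutput a₀ a₁ Δ κ α u y x‖ ^ 2 := by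
  simp_rw [qSE_eq, norm_mul, mul_pow, Complex.norm_real, Real.norm_eq_abs, sq_abs]
  rw [integral_const_mul]

lemma qSEFidelity_eq (hN : circuitNorm Δ κ ≠ 0) (α u xm : ℝ)
    (hI : ∫ x, ‖rawOutput a₀ a₁ Δ κ α u xm x‖ ^ 2 ≠ 0) :
    qSEFidelity a₀ a₁ Δ κ α u xm = fidelity (rawOutput a₀ a₁ Δ κ α u xm)
      (fun x => qubit a₀ a₁ (Δ / √2) (κ * √2)
        (α / 2 - step (xm - α * √(Real.pi / 2))) (x - u / 2)) := by
  unfold qSEFidelity qSEOutput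
  rw [integral_norm_sq_qSE]
  simp_rw [qSE_eq, ← mul_assoc]
  refine fidelity_const_mul (mul_ne_zero ?_ (by exact_mod_cast hN)) _ _
  have h0 : 0 ≤ ∫ x, ‖rawOutput a₀ a₁ Δ κ α u xm x‖ ^ 2 := integral_nonneg fun x => by positivity
  have h1 : 0 < ∫ x, ‖rawOutput a₀ a₁ Δ κ α u xm x‖ ^ 2 := lt_of_le_of_ne h0 hI.symm
  have : 0 < circuitNorm Δ κ ^ 2 * ∫ x, ‖rawOutput a₀ a₁ Δ κ α u xm x‖ ^ 2 := by positivity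
  have h3 := Real.sqrt_pos.2 this
  exact_mod_cast (inv_pos.2 h3).ne'

/-- The infidelity weighted with the unnormalized probability density of the result. -/
lemma one_sub_qSEFidelity_mul_le (hε0 : 0 ≤ ε) (hε : ε ≤ 1 / 3) (h : SmallTails ε Δ κ)
    (α u xm : ℝ) (l : ℂ) :
    (1 - qSEFidelity a₀ a₁ Δ κ α u xm) * ∫ x, ‖rawOutput a₀ a₁ Δ κ α u xm x‖ ^ 2 ≤
      ∫ x, ‖rawOutput a₀ a₁ Δ κ α u xm x - l * qubit a₀ a₁ (Δ / √2) (κ * √2)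
        (α / 2 - step (xm - α * √(Real.pi / 2))) (x - u / 2)‖ ^ 2 := by
  have hΔ := h.1
  have hκ := h.2.1
  -- A result of density zero has no normalized output, but its weight in the inequality is zero.
  by_cases hI : ∫ x, ‖rawOutput a₀ a₁ Δ κ α u xm x‖ ^ 2 = 0
  · rw [hI, mul_zero]
    exact integral_nonneg fun x => by positivity
  · rw [qSEFidelity_eq (circuitNorm_pos hε0 hε h).ne' α u xm hI]
    exact one_sub_fidelity_mul_le (memLp_rawOutput hε0 (by linarith) h _ _ _ _ _)
      (memLp_qubit_comp_sub _ _ (by positivity) (by positivity) _ _) l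

lemma exists_smallTails_pair {ε : ℝ} (hε : 0 < ε) : ∃ η : ℝ, 0 < η ∧
    ∀ Δ κ : ℝ, 0 < Δ → Δ < η → 0 < κ → κ < η →
      SmallTails ε Δ κ ∧ SmallTails ε (Δ / √2) (κ * √2) := by
  obtain ⟨η, h0, h⟩ := exists_smallTails hε
  refine ⟨η / 2, by positivity, fun Δ κ h1 h2 h3 h4 => ⟨h _ _ h1 (by linarith) h3 (by linarith),
    h _ _ (by positivity) ?_ (by positivity) ?_⟩⟩
  · have : Δ / √2 ≤ Δ := div_le_self h1.le (Real.one_le_sqrt.2 (by norm_num))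
    linarith
  · have : √2 ≤ 2 := Real.sqrt_le_left (by norm_num) |>.2 (by norm_num)
    nlinarith

/-- Away from ties in the rounding, the other peaks are negligible. -/
lemma otherWeight_le {δ R α t : ℝ} (hδ : 0 < δ) (hΔ : 0 < Δ) (hκ : 0 < κ) (hκ1 : κ ≤ 1) {k₀ : ℤ}
    (ht : |t - k₀| ≤ 1 / 2 - δ) (hR : |t + α| ≤ R / κ) :
    otherWeight Δ κ α t k₀ ≤ peakWeight Δ κ α t k₀ *
      (Real.exp (Real.pi / 4 * (R + 1) ^ 2) * gaussTail (Real.pi * δ / 2 / Δ ^ 2)) := by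
  -- This bounds the loss from comparing envelopes: the peak $k_0$ lies within $(R+1)/\kappa$ of the
  -- envelope center, so its own envelope factor is at least $e^{-\pi(R+1)^2/4}$.
  have hκR : (κ * (k₀ + α)) ^ 2 ≤ (R + 1) ^ 2 := by
    apply sq_le_sq'
    · rw [le_div_iff₀ hκ] at hR
      have := (abs_le.1 ht).2
      have := neg_abs_le (t + α)
      nlinarith
    · rw [le_div_iff₀ hκ] at hR
      have := (abs_le.1 ht).1
      have := le_abs_self (t + α)
      nlinarith
  have ht1 := abs_le.1 ht
  unfold otherWeight gaussTail
  rw [← mul_assoc, ← tsum_mul_left, ← (Equiv.addRight k₀).tsum_eq]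
  refine Summable.tsum_le_tsum (fun j => ?_) ?_ ((summable_gaussTail (by positivity)).mul_left _)
  · simp only [Equiv.coe_addRight, add_eq_right]
    split_ifs with hj
    · simp
    · unfold peakWeight outEnvelope
      rw [← Real.exp_add, ← Real.exp_add, ← Real.exp_add, ← Real.exp_add]
      apply Real.exp_le_exp.2
      push_cast
      have hj2 : |(j : ℝ)| ≤ (j : ℝ) ^ 2 := by
        have : |j| ≤ j ^ 2 := by
          rw [← sq_abs]
          have := Int.one_le_abs hj
          nlinarith
        exact_mod_cast this
      -- The cross term $2(t-k_0)j$ is at most $(1-2\delta)j^2$ because $|j|\le j^2$ for integers;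
      -- distance from a tie leaves $2\delta j^2$.
      have key : (t - k₀) ^ 2 + 2 * δ * (j : ℝ) ^ 2 ≤ (t - (j + k₀)) ^ 2 := by
        have h1 : (t - k₀) * j ≤ (1 / 2 - δ) * (j : ℝ) ^ 2 := by
          calc _ ≤ |(t - k₀) * j| := le_abs_self _
            _ = |t - k₀| * |(j : ℝ)| := abs_mul _ _
            _ ≤ _ := mul_le_mul ht hj2 (abs_nonneg _) (by linarith)
        nlinarith
      have e1 : Real.pi / (4 * Δ ^ 2) * ((t - k₀) ^ 2 + 2 * δ * (j : ℝ) ^ 2) ≤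
          Real.pi / (4 * Δ ^ 2) * (t - (j + k₀)) ^ 2 :=
        mul_le_mul_of_nonneg_left key (by positivity)
      have e2 : Real.pi / (4 * Δ ^ 2) * (2 * δ * (j : ℝ) ^ 2) =
          Real.pi * δ / 2 / Δ ^ 2 * (j : ℝ) ^ 2 := by
        field_simp
        norm_num
      have e3 : 0 ≤ Real.pi * κ ^ 2 / 4 * (j + k₀ + α) ^ 2 := by positivity
      have e4 : Real.pi / 4 * (κ * (k₀ + α)) ^ 2 ≤ Real.pi / 4 * (R + 1) ^ 2 := by gcongr
      linarith
  · exact (summable_otherWeight Δ hκ α t k₀).comp_injective (Equiv.addRight k₀).injective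

end

/-! ### Fidelity for a single measurement result. -/

theorem fidelity_of_no_error (ε : ℝ) (hε : 0 < ε) (δ : ℝ) (hδ : 0 < δ) (R : ℝ) :
    ∃ η : ℝ, 0 < η ∧ ∀ Δ κ : ℝ, 0 < Δ → Δ < η → 0 < κ → κ < η →
      ∀ a₀ a₁ : ℂ, (a₀ ≠ 0 ∨ a₁ ≠ 0) → ∀ α u xm : ℝ,
        |(xm - α * √(Real.pi / 2) - u / √2) / √(Real.pi / 2)
            - round ((xm - α * √(Real.pi / 2) - u / √2) / √(Real.pi / 2))| ≤ 1 / 2 - δ →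
        |xm - u / √2| ≤ R / κ →
        GKP.step (xm - α * √(Real.pi / 2) - u / √2) = GKP.step (xm - α * √(Real.pi / 2)) →
        1 - ε ≤ GKP.qSEFidelity a₀ a₁ Δ κ α u xm := by
  set e := min ε 1 / 100000 with he
  have he0 : 0 < e := by positivity
  have he1 : e ≤ 1 / 100000 := by
    rw [he]; gcongr; exact min_le_right _ _
  have heε : 100000 * e ≤ ε := by
    rw [he]; linarith [min_le_left ε 1]
  obtain ⟨η₁, h₁, H₁⟩ := exists_smallTails_pair he0
  set C := Real.exp (Real.pi / 4 * (R + 1) ^ 2) with hC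
  have hC0 : 0 < C := Real.exp_pos _
  obtain ⟨η₂, h₂, H₂⟩ := exists_gaussTail_div_sq_le (c := Real.pi * δ / 2) (by positivity)
    (show 0 < e / C by positivity)
  refine ⟨min (min η₁ η₂) 1, by positivity, fun Δ κ hΔ hΔη hκ hκη a₀ a₁ ha α u xm ht hx hs => ?_⟩
  simp only [lt_min_iff] at hΔη hκη
  obtain ⟨h, h'⟩ := H₁ Δ κ hΔ hΔη.1.1 hκ hκη.1.1
  set t := scaledResult α u xm with htd
  change |t - round t| ≤ 1 / 2 - δ at ht
  have hπ1 : 1 ≤ √(Real.pi / 2) := Real.one_le_sqrt.2 (by linarith [Real.pi_gt_three])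
  have htα : |t + α| ≤ R / κ := by
    have : t + α = (xm - u / √2) / √(Real.pi / 2) := by
      rw [htd, scaledResult]
      field_simp
      ring
    rw [this, abs_div, abs_of_pos (show 0 < √(Real.pi / 2) by linarith)]
    exact (div_le_self (abs_nonneg _) hπ1).trans hx
  have hW := otherWeight_le hδ hΔ hκ hκη.2.le ht htα
  have hw := peakWeight_pos Δ κ α t (round t)
  have hW' : otherWeight Δ κ α t (round t) ≤ e * peakWeight Δ κ α t (round t) := by
    refine hW.trans ?_
    have h3 : C * gaussTail (Real.pi * δ / 2 / Δ ^ 2) ≤ C * (e / C) :=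
      mul_le_mul_of_nonneg_left (H₂ Δ hΔ hΔη.1.2) hC0.le
    rw [mul_div_cancel₀ _ hC0.ne'] at h3
    rw [mul_comm e]
    exact mul_le_mul_of_nonneg_left h3 hw.le
  have hW0 : 0 ≤ otherWeight Δ κ α t (round t) := tsum_nonneg fun k => by
    split_ifs
    · exact le_rfl
    · exact (peakWeight_pos _ _ _ _ k).le
  have hstep : step (xm - α * √(Real.pi / 2)) = ((round t % 4 : ℤ) : ℝ) / 2 := by
    rw [← hs]; rfl
  obtain ⟨A, hA0, hA, -, -⟩ := exists_amplitude a₀ a₁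
  obtain ⟨l, hl1, hl2⟩ := exists_rawOutput_approx he0.le (by linarith) h h' hA hA0
    (sqrt_pi_mul_scaledResult α u xm) (round t)
  have hF := one_sub_qSEFidelity_mul_le (a₀ := a₀) (a₁ := a₁) he0.le (by linarith) h α u xm (l : ℂ)
  have hm1 := memLp_rawOutput he0.le (by linarith) h a₀ a₁ α u xm
  have hm2 := memLp_qubit_comp_sub a₀ a₁ (show 0 < Δ / √2 by positivity)
    (show 0 < κ * √2 by positivity) (α / 2 - ((round t % 4 : ℤ) : ℝ) / 2) (u / 2)
  rw [hstep] at hF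
  set r := rawOutput a₀ a₁ Δ κ α u xm
  set g : ℝ → ℂ := fun x => qubit a₀ a₁ (Δ / √2) (κ * √2)
    (α / 2 - ((round t % 4 : ℤ) : ℝ) / 2) (x - u / 2) with hg
  have hm3 : MemLp (fun x => r x - (l : ℂ) * g x) 2 := hm1.sub (hm2.const_mul _)
  have hi1 := (memLp_two_iff_integrable_sq_norm hm1.1).1 hm1
  have hi3 := (memLp_two_iff_integrable_sq_norm hm3.1).1 hm3
  -- The infidelity bound is relative to the norm of the output, while the error is small relative
  -- to that of the prediction; the triangle inequality converts one into the other.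
  have hL : l ^ 2 * ∫ x, ‖g x‖ ^ 2 ≤
      2 * (∫ x, ‖r x - (l : ℂ) * g x‖ ^ 2) + 2 * ∫ x, ‖r x‖ ^ 2 := by
    rw [← integral_const_mul, ← integral_const_mul, ← integral_const_mul,
      ← integral_add (hi3.const_mul 2) (hi1.const_mul 2)]
    refine integral_mono_of_nonneg (ae_of_all _ fun x => by positivity)
      ((hi3.const_mul 2).add (hi1.const_mul 2)) (ae_of_all _ fun x => ?_)
    have h4 := norm_add_sq_le_two_mul (-(r x - (l : ℂ) * g x)) (r x)
    rw [norm_neg, show -(r x - (l : ℂ) * g x) + r x = (l : ℂ) * g x by ring, norm_mul,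
      Complex.norm_real, mul_pow, Real.norm_eq_abs, sq_abs] at h4
    exact h4
  have hApos : 0 < A ^ 2 := by
    rw [hA]
    rcases ha with ha | ha
    · have := norm_pos_iff.2 ha; positivity
    · have := norm_pos_iff.2 ha; positivity
  set w := peakWeight Δ κ α t (round t)
  set W := otherWeight Δ κ α t (round t)
  set X := A ^ 2 * (κ / Δ) with hX
  have hX0 : 0 < X := by positivity
  change ∫ x, ‖r x - (l : ℂ) * g x‖ ^ 2 ≤ 2000 * (X * (e ^ 2 * w ^ 2 + W ^ 2)) at hl1
  change X * w ^ 2 / 4 ≤ l ^ 2 * ∫ x, ‖g x‖ ^ 2 at hl2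
  change (1 - qSEFidelity a₀ a₁ Δ κ α u xm) * ∫ x, ‖r x‖ ^ 2 ≤
    ∫ x, ‖r x - (l : ℂ) * g x‖ ^ 2 at hF
  set D := ∫ x, ‖r x - (l : ℂ) * g x‖ ^ 2
  set I := ∫ x, ‖r x‖ ^ 2
  set Q := l ^ 2 * ∫ x, ‖g x‖ ^ 2
  have hWs : W ^ 2 ≤ e ^ 2 * w ^ 2 := by
    rw [← mul_pow]; exact pow_le_pow_left₀ hW0 hW' 2
  have hXw : 0 < X * w ^ 2 := by positivity
  have hD1 : D ≤ 4000 * e ^ 2 * (X * w ^ 2) := by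
    refine hl1.trans ?_
    have := mul_le_mul_of_nonneg_left hWs hX0.le
    linarith
  have hD2 : D ≤ 16000 * e ^ 2 * Q := by
    refine hD1.trans ?_
    have := mul_le_mul_of_nonneg_left hl2 (show 0 ≤ 16000 * e ^ 2 by positivity)
    linarith
  have hQ0 : 0 < Q := lt_of_lt_of_le (by positivity) hl2
  -- The factor $10^{-5}$ in `e` makes $D\le eQ$ with $Q\le4I$, so the infidelity is at most
  -- $4e\le\varepsilon$.
  have he2 : 16000 * e ^ 2 ≤ e := by
    have := mul_le_mul_of_nonneg_left he1 he0.le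
    linarith
  have hD3 : D ≤ e * Q := hD2.trans (mul_le_mul_of_nonneg_right he2 hQ0.le)
  have heQ : e * Q ≤ 1 / 100000 * Q := mul_le_mul_of_nonneg_right he1 hQ0.le
  have hQI : Q ≤ 4 * I := by linarith
  have hI0 : 0 < I := by linarith
  have hfin : (1 - qSEFidelity a₀ a₁ Δ κ α u xm) * I ≤ (4 * e) * I := by
    have := mul_le_mul_of_nonneg_left hQI he0.le
    linarith
  have := le_of_mul_le_mul_right hfin hI0
  linarith

/-! ### Domination of the infidelity by a Gaussian mixture. -/

/-- Cauchy–Schwarz for sums of nonnegative reals. -/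
lemma tsum_sq_le_tsum_mul_tsum {ι : Type*} {c a b : ι → ℝ} (hc0 : ∀ i, 0 ≤ c i)
    (ha0 : ∀ i, 0 ≤ a i) (hb0 : ∀ i, 0 ≤ b i) (hc : ∀ i, c i ^ 2 ≤ a i * b i) (ha : Summable a)
    (hb : Summable b) : (∑' i, c i) ^ 2 ≤ (∑' i, a i) * ∑' i, b i := by
  have hA : 0 ≤ ∑' i, a i := tsum_nonneg ha0
  have hB : 0 ≤ ∑' i, b i := tsum_nonneg hb0
  have h : ∑' i, c i ≤ √((∑' i, a i) * ∑' i, b i) := by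
    refine Real.tsum_le_of_sum_le hc0 fun s => Real.le_sqrt_of_sq_le ?_
    calc (∑ i ∈ s, c i) ^ 2 ≤ (∑ i ∈ s, √(a i) * √(b i)) ^ 2 := by
          refine pow_le_pow_left₀ (Finset.sum_nonneg fun i _ => hc0 i) (Finset.sum_le_sum
            fun i _ => ?_) 2
          rw [← Real.sqrt_mul (ha0 i)]
          exact Real.le_sqrt_of_sq_le (hc i)
      _ ≤ (∑ i ∈ s, √(a i) ^ 2) * ∑ i ∈ s, √(b i) ^ 2 := Finset.sum_mul_sq_le_sq_mul_sq _ _ _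
      _ = (∑ i ∈ s, a i) * ∑ i ∈ s, b i := by
          congr 1
          · exact Finset.sum_congr rfl fun i _ => Real.sq_sqrt (ha0 i)
          · exact Finset.sum_congr rfl fun i _ => Real.sq_sqrt (hb0 i)
      _ ≤ _ := mul_le_mul (ha.sum_le_tsum s fun i _ => ha0 i) (hb.sum_le_tsum s fun i _ => hb0 i)
          (Finset.sum_nonneg fun i _ => hb0 i) hA
  have := pow_le_pow_left₀ (tsum_nonneg hc0) h 2
  rwa [Real.sq_sqrt (mul_nonneg hA hB)] at this

/-- A mixture of Gaussians that dominates the squared weights of the peaks. -/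
noncomputable def weightEnvelope (Δ κ α t : ℝ) : ℝ :=
  ∑' k : ℤ, outEnvelope κ α k ^ 2 * Real.exp (-(Real.pi / (8 * Δ ^ 2)) * (t - k) ^ 2)

section
variable {ε Δ κ : ℝ}

lemma weightEnvelope_term_le (Δ κ α t : ℝ) (k : ℤ) :
    outEnvelope κ α k ^ 2 * Real.exp (-(Real.pi / (8 * Δ ^ 2)) * (t - k) ^ 2) ≤
      outEnvelope κ α k ^ 2 := by
  refine mul_le_of_le_one_right (by positivity) ?_
  rw [Real.exp_le_one_iff, neg_mul, neg_nonpos]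
  positivity

lemma summable_weightEnvelope (Δ : ℝ) (hκ : 0 < κ) (α t : ℝ) : Summable fun k : ℤ =>
    outEnvelope κ α k ^ 2 * Real.exp (-(Real.pi / (8 * Δ ^ 2)) * (t - k) ^ 2) :=
  Summable.of_nonneg_of_le (fun _ => by positivity) (weightEnvelope_term_le Δ κ α t)
    (summable_outEnvelope_sq hκ α)

lemma peakWeight_sq_le_weightEnvelope (Δ : ℝ) (hκ : 0 < κ) (α t : ℝ) (k : ℤ) :
    peakWeight Δ κ α t k ^ 2 ≤ weightEnvelope Δ κ α t := by
  refine le_trans ?_ ((summable_weightEnvelope Δ hκ α t).le_tsum k fun _ _ => by positivity)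
  unfold peakWeight
  rw [mul_pow]
  refine mul_le_mul_of_nonneg_left ?_ (by positivity)
  rw [← Real.exp_nat_mul]
  apply Real.exp_le_exp.2
  have h : 0 ≤ Real.pi / Δ ^ 2 * (t - k) ^ 2 := by positivity
  have e1 : ((2 : ℕ) : ℝ) * (-(Real.pi / (4 * Δ ^ 2)) * (t - k) ^ 2) =
      -(1 / 2) * (Real.pi / Δ ^ 2 * (t - k) ^ 2) := by
    push_cast
    rw [mul_comm 4, ← div_div]
    ring
  have e2 : -(Real.pi / (8 * Δ ^ 2)) * (t - k) ^ 2 =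
      -(1 / 8) * (Real.pi / Δ ^ 2 * (t - k) ^ 2) := by
    rw [mul_comm 8, ← div_div]
    ring
  rw [e1, e2]
  linarith

/-- Weights of peaks at a distance from the measurement result are negligible. -/
lemma tsum_sq_le_weightEnvelope (hΔ : 0 < Δ) (hΔ1 : Δ ≤ 1 / 3) (hκ : 0 < κ) {α t ρ : ℝ}
    (hρ : 0 ≤ ρ) {τ : ℤ → ℝ} (hτ0 : ∀ k, 0 ≤ τ k) (hτ : ∀ k, τ k ≤ peakWeight Δ κ α t k)
    (hfar : ∀ k : ℤ, |t - k| < ρ → τ k = 0) :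
    (∑' k, τ k) ^ 2 ≤ Real.exp (-(Real.pi * ρ ^ 2 / 4 / Δ ^ 2)) * (1 + gaussTail Real.pi) *
      weightEnvelope Δ κ α t := by
  set a : ℤ → ℝ := fun k =>
    outEnvelope κ α k ^ 2 * Real.exp (-(Real.pi / (8 * Δ ^ 2)) * (t - k) ^ 2)
  set b : ℤ → ℝ := fun k =>
    Real.exp (-(Real.pi * ρ ^ 2 / 4 / Δ ^ 2)) * Real.exp (-Real.pi * ((k : ℝ) + -t) ^ 2)
  have hbs : Summable b := (summable_exp_int_sq Real.pi_pos (-t)).mul_left _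
  have hsq : ∀ k, τ k ^ 2 ≤ a k * b k := by
    intro k
    rcases lt_or_ge |t - k| ρ with hk | hk
    · rw [hfar k hk, zero_pow two_ne_zero]
      positivity
    · refine (pow_le_pow_left₀ (hτ0 k) (hτ k) 2).trans ?_
      simp only [a, b, peakWeight]
      rw [mul_pow, mul_assoc]
      refine mul_le_mul_of_nonneg_left ?_ (by positivity)
      -- The exponent $\frac12\cdot\pi(t-k)^2/\Delta^2$ is split as $\frac18+\frac14+\frac18$: one
      -- eighth stays in the mixture, one quarter gives the small factor since $|t-k|\ge\rho$, and
      -- the last eighth exceeds $\pi(t-k)^2$ because $\Delta\le\frac13$, which makes `b` summable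
      -- uniformly in `t`.
      rw [← Real.exp_nat_mul, ← Real.exp_add, ← Real.exp_add]
      apply Real.exp_le_exp.2
      have h1 : ρ ^ 2 ≤ (t - k) ^ 2 := by
        rw [← sq_abs (t - k)]
        exact pow_le_pow_left₀ hρ hk 2
      have h2 : 9 ≤ 1 / Δ ^ 2 := by
        rw [le_div_iff₀ (by positivity)]
        nlinarith
      have e1 : Real.pi / (4 * Δ ^ 2) = Real.pi / 4 * (1 / Δ ^ 2) := by
        field_simp
      have e2 : Real.pi / (8 * Δ ^ 2) = Real.pi / 8 * (1 / Δ ^ 2) := by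
        field_simp
      have e3 : Real.pi * ρ ^ 2 / 4 / Δ ^ 2 = Real.pi / 4 * (1 / Δ ^ 2) * ρ ^ 2 := by
        field_simp
      rw [e1, e2, e3]
      have h3 : Real.pi / 4 * (1 / Δ ^ 2) * ρ ^ 2 ≤ Real.pi / 4 * (1 / Δ ^ 2) * (t - k) ^ 2 :=
        mul_le_mul_of_nonneg_left h1 (by positivity)
      have h4 : Real.pi / 8 * 9 * (t - k) ^ 2 ≤ Real.pi / 8 * (1 / Δ ^ 2) * (t - k) ^ 2 := by
        gcongr
      have h5 : 0 ≤ Real.pi * (t - k) ^ 2 := by positivity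
      push_cast
      nlinarith
  refine (tsum_sq_le_tsum_mul_tsum hτ0 (fun k => by positivity) (fun k => by positivity) hsq
    (summable_weightEnvelope Δ hκ α t) hbs).trans ?_
  have hb : ∑' k, b k ≤ Real.exp (-(Real.pi * ρ ^ 2 / 4 / Δ ^ 2)) * (1 + gaussTail Real.pi) := by
    simp only [b]
    rw [tsum_mul_left]
    have := (abs_le.1 (abs_tsum_exp_sub_le (τ := 1) one_pos (-t))).2
    simp only [mul_one, Real.sqrt_one, div_one, one_mul] at this
    gcongr
    linarith
  calc _ ≤ (∑' k, a k) * (Real.exp (-(Real.pi * ρ ^ 2 / 4 / Δ ^ 2)) * (1 + gaussTail Real.pi)) :=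
        mul_le_mul_of_nonneg_left hb (tsum_nonneg fun k => by positivity)
    _ = _ := mul_comm _ _

/-- The term $j=1$. It lets `exists_gaussTail_div_sq_le` also supply thresholds for single
exponentials. -/
lemma exp_neg_le_gaussTail {a : ℝ} (ha : 0 < a) : Real.exp (-a) ≤ gaussTail a := by
  have := (summable_gaussTail ha).le_tsum 1 fun j _ => by split_ifs <;> positivity
  simpa [gaussTail] using this

lemma integrable_weightEnvelope (h : SmallTails ε Δ κ) (hε : ε ≤ 1) (α : ℝ) :
    Integrable (weightEnvelope Δ κ α) ∧ ∫ t, weightEnvelope Δ κ α t ≤ 9 * Δ / κ := by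
  have hΔ := h.1
  have hκ := h.2.1
  have hF : ∀ k : ℤ, Integrable fun t : ℝ =>
      outEnvelope κ α k ^ 2 * Real.exp (-(Real.pi / (8 * Δ ^ 2)) * (t - k) ^ 2) := fun k =>
    ((integrable_exp_neg_mul_sq (by positivity)).comp_sub_right (k : ℝ)).const_mul _
  have hint : ∀ k : ℤ, ∫ t : ℝ,
      outEnvelope κ α k ^ 2 * Real.exp (-(Real.pi / (8 * Δ ^ 2)) * (t - k) ^ 2) =
      outEnvelope κ α k ^ 2 * √(8 * Δ ^ 2) := by
    intro k
    rw [integral_const_mul, integral_sub_right_eq_self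
      fun t : ℝ => Real.exp (-(Real.pi / (8 * Δ ^ 2)) * t ^ 2), integral_gaussian,
      div_div_cancel₀ Real.pi_ne_zero]
  have hnorm : ∀ (k : ℤ) (t : ℝ),
      ‖outEnvelope κ α k ^ 2 * Real.exp (-(Real.pi / (8 * Δ ^ 2)) * (t - k) ^ 2)‖ =
      outEnvelope κ α k ^ 2 * Real.exp (-(Real.pi / (8 * Δ ^ 2)) * (t - k) ^ 2) := fun k t =>
    Real.norm_of_nonneg (by positivity)
  have hs : Summable fun k : ℤ => ∫ t : ℝ,
      ‖outEnvelope κ α k ^ 2 * Real.exp (-(Real.pi / (8 * Δ ^ 2)) * (t - k) ^ 2)‖ := by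
    simp_rw [hnorm, hint]
    exact (summable_outEnvelope_sq hκ α).mul_right _
  have hc : Continuous (weightEnvelope Δ κ α) := by
    unfold weightEnvelope
    refine continuous_tsum (fun k => by fun_prop) (summable_outEnvelope_sq hκ α) fun k t => ?_
    rw [hnorm]
    exact weightEnvelope_term_le Δ κ α t k
  refine ⟨integrable_tsum_of_summable hc.aestronglyMeasurable hF hs, ?_⟩
  have h8 : √(8 * Δ ^ 2) ≤ 3 * Δ := by
    rw [Real.sqrt_le_left (by positivity)]
    nlinarith [sq_nonneg Δ]
  calc ∫ t, weightEnvelope Δ κ α t = ∑' k : ℤ, outEnvelope κ α k ^ 2 * √(8 * Δ ^ 2) := by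
        unfold weightEnvelope
        rw [← (hasSum_integral_of_summable_integral_norm hF hs).tsum_eq]
        exact tsum_congr hint
    _ = (∑' k : ℤ, outEnvelope κ α k ^ 2) * √(8 * Δ ^ 2) := tsum_mul_right
    _ ≤ 3 / κ * (3 * Δ) := by
        gcongr
        exact tsum_outEnvelope_sq_le hε h α
    _ = _ := by ring

lemma integrable_weightEnvelope_scaledResult (h : SmallTails ε Δ κ) (hε : ε ≤ 1) (α u : ℝ) :
    Integrable (fun xm => weightEnvelope Δ κ α (scaledResult α u xm)) ∧
      ∫ xm, weightEnvelope Δ κ α (scaledResult α u xm) ≤ 15 * Δ / κ := by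
  have hΔ := h.1
  have hκ := h.2.1
  obtain ⟨hi, hb⟩ := integrable_weightEnvelope h hε α
  have hs : 0 < √(Real.pi / 2) := by positivity
  have hs1 : √(Real.pi / 2) ≤ 3 / 2 := by
    rw [Real.sqrt_le_left (by norm_num)]
    linarith [Real.pi_lt_four]
  have he : (fun xm => weightEnvelope Δ κ α (scaledResult α u xm)) = fun xm =>
      (fun z => weightEnvelope Δ κ α (z / √(Real.pi / 2))) (xm - (α * √(Real.pi / 2) + u / √2)) := by
    ext xm
    rw [scaledResult, sub_sub]
  rw [he]
  refine ⟨(hi.comp_div hs.ne').comp_sub_right _, ?_⟩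
  rw [integral_sub_right_eq_self fun z => weightEnvelope Δ κ α (z / √(Real.pi / 2)),
    Measure.integral_comp_div, abs_of_pos hs, smul_eq_mul]
  have h0 : 0 ≤ Δ / κ := by positivity
  calc _ ≤ 3 / 2 * (9 * Δ / κ) :=
        mul_le_mul hs1 hb (integral_nonneg fun t => tsum_nonneg fun k => by positivity) (by norm_num)
    _ = 27 / 2 * (Δ / κ) := by ring
    _ ≤ 15 * (Δ / κ) := by linarith
    _ = _ := by ring

variable {a₀ a₁ : ℂ} {A : ℝ}

/-- The total probability, up to normalization. -/
lemma integral_rawOutput_ge (hε0 : 0 ≤ ε) (hε : ε ≤ 1 / 3) (h : SmallTails ε Δ κ)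
    (hA : A ^ 2 = ‖a₀‖ ^ 2 + ‖a₁‖ ^ 2) (α u : ℝ) :
    Integrable (fun y => ∫ x, ‖rawOutput a₀ a₁ Δ κ α u y x‖ ^ 2) ∧
      A ^ 2 / 3 ≤ ∫ y, ∫ x, ‖rawOutput a₀ a₁ Δ κ α u y x‖ ^ 2 := by
  have hΔ := h.1
  have hκ := h.2.1
  set P : ℝ → ℝ := fun z => ‖qubit 1 1 Δ κ 0 z‖ ^ 2 with hP
  set Q : ℝ → ℝ := fun z => ‖qubit a₀ a₁ Δ κ α (z - u)‖ ^ 2 with hQ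
  have hPi : Integrable P := integrable_norm_sq_qubit 1 1 hΔ hκ 0
  have hQi : Integrable Q := (integrable_norm_sq_qubit a₀ a₁ hΔ hκ α).comp_sub_right u
  have hP1 : 1 ≤ ∫ z, P z := by
    have := le_integral_norm_sq_qubit hε0 hε h 1 1 0
    norm_num at this
    exact this
  have hQ1 : A ^ 2 / 2 ≤ ∫ z, Q z := by
    rw [hQ, integral_sub_right_eq_self fun z => ‖qubit a₀ a₁ Δ κ α z‖ ^ 2, hA]
    exact le_integral_norm_sq_qubit hε0 hε h a₀ a₁ α
  -- The beam splitter turns the measured position into a sum of two independent positions, so the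
  -- unnormalized density is a rescaled convolution and its integral factorizes.
  have hconv : (fun y => ∫ x, ‖rawOutput a₀ a₁ Δ κ α u y x‖ ^ 2) =
      fun y => convolution P Q (ContinuousLinearMap.mul ℝ ℝ) volume (√2 * y) := by
    ext y
    rw [convolution_def, ← integral_sub_left_eq_self _ volume (y / √2)]
    refine integral_congr_ae (ae_of_all _ fun x => ?_)
    simp only [ContinuousLinearMap.mul_apply', rawOutput, norm_mul, mul_pow, hP, hQ]
    have h2 : √2 * √2 = 2 := Real.mul_self_sqrt (by norm_num)
    have e : √2 * y - x = y / √2 - x + y / √2 := by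
      field_simp
      linear_combination y * h2
    rw [e, show -(y / √2 - x) + y / √2 = x by ring, mul_comm]
  have hci := hPi.integrable_convolution (ContinuousLinearMap.mul ℝ ℝ) hQi
  rw [hconv]
  refine ⟨hci.comp_mul_left' (by positivity), ?_⟩
  rw [Measure.integral_comp_mul_left (convolution P Q (ContinuousLinearMap.mul ℝ ℝ) volume),
    integral_convolution _ hPi hQi, ContinuousLinearMap.mul_apply', smul_eq_mul,
    abs_of_pos (by positivity)]
  have hs : 2 / 3 ≤ (√2)⁻¹ := by
    rw [le_inv_comm₀ (by norm_num) (by positivity), Real.sqrt_le_left (by norm_num)]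
    norm_num
  calc A ^ 2 / 3 = 2 / 3 * (1 * (A ^ 2 / 2)) := by ring
    _ ≤ _ := by gcongr

lemma round_eq_of_abs_sub_lt {y : ℝ} {k : ℤ} (h : |y - k| < 1 / 2) : round y = k := by
  rw [round_eq, Int.floor_eq_iff]
  have := abs_lt.1 h
  constructor <;> linarith

/-- The infidelity is dominated by the weight envelope, whatever the measurement result. -/
lemma one_sub_qSEFidelity_mul_le_weightEnvelope (hε0 : 0 ≤ ε) (hε : ε ≤ 1 / 3)
    (h : SmallTails ε Δ κ) (h' : SmallTails ε (Δ / √2) (κ * √2)) (hΔ1 : Δ ≤ 1 / 3)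
    (hA : A ^ 2 = ‖a₀‖ ^ 2 + ‖a₁‖ ^ 2) (hA0 : 0 ≤ A) {u r : ℝ} (hu : |u| ≤ r)
    (hr : r < √Real.pi / 2) (hexp : Real.exp (-(Real.pi * (1 / 2 - r / √Real.pi) ^ 2 / 4 / Δ ^ 2)) *
      (1 + gaussTail Real.pi) ≤ ε) (α xm : ℝ) :
    (1 - qSEFidelity a₀ a₁ Δ κ α u xm) * ∫ x, ‖rawOutput a₀ a₁ Δ κ α u xm x‖ ^ 2 ≤
      4000 * ε * (A ^ 2 * (κ / Δ)) * weightEnvelope Δ κ α (scaledResult α u xm) := by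
  have hΔ := h.1
  have hκ := h.2.1
  have hsp : 0 < √Real.pi := by positivity
  set ρ := 1 / 2 - r / √Real.pi with hρd
  have hρ : 0 ≤ ρ := by
    rw [hρd, sub_nonneg, div_le_iff₀ hsp]
    linarith
  have hr0 : 0 ≤ r := (abs_nonneg _).trans hu
  have hρ2 : ρ ≤ 1 / 2 := by
    have : 0 ≤ r / √Real.pi := by positivity
    linarith
  set t := scaledResult α u xm with ht
  set X := A ^ 2 * (κ / Δ) with hX
  have hX0 : 0 ≤ X := by positivity
  set U := weightEnvelope Δ κ α t with hU
  have hU0 : 0 ≤ U := tsum_nonneg fun k => by positivity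
  have h0 : ‖a₀‖ ≤ A := (pow_le_pow_iff_left₀ (norm_nonneg _) hA0 two_ne_zero).1
    (by rw [hA]; linarith [sq_nonneg ‖a₁‖])
  have h1 : ‖a₁‖ ≤ A := (pow_le_pow_iff_left₀ (norm_nonneg _) hA0 two_ne_zero).1
    (by rw [hA]; linarith [sq_nonneg ‖a₀‖])
  have hstep : step (xm - α * √(Real.pi / 2)) =
      ((round (t + u / √Real.pi) % 4 : ℤ) : ℝ) / 2 := by
    unfold step
    have : (xm - α * √(Real.pi / 2)) / √(Real.pi / 2) = t + u / √Real.pi := by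
      rw [ht, scaledResult, Real.sqrt_div Real.pi_pos.le]
      field_simp
      ring
    rw [this]
  -- Within $\rho$ of an integer, a shift by $|u|/\sqrt\pi\le r/\sqrt\pi=\frac12-\rho$ crosses no
  -- tie and the prediction uses the right peak. Otherwise the infidelity is only bounded by 1, but
  -- all peaks are at distance at least $\rho$ from `t` and the output itself is small.
  by_cases hg : |t - round t| < ρ
  · have hround : round (t + u / √Real.pi) = round t := by
      apply round_eq_of_abs_sub_lt
      have : |u / √Real.pi| ≤ r / √Real.pi := by
        rw [abs_div, abs_of_pos hsp]
        gcongr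
      calc |t + u / √Real.pi - round t| = |(t - round t) + u / √Real.pi| := by congr 1; ring
        _ ≤ |t - round t| + |u / √Real.pi| := abs_add_le _ _
        _ < 1 / 2 := by linarith
    rw [hround] at hstep
    obtain ⟨l, hl, -⟩ := exists_rawOutput_approx hε0 hε h h' hA hA0
      (sqrt_pi_mul_scaledResult α u xm) (round t)
    refine (one_sub_qSEFidelity_mul_le hε0 hε h α u xm (l : ℂ)).trans ?_
    rw [hstep]
    refine hl.trans ?_
    have hw := peakWeight_sq_le_weightEnvelope Δ hκ α t (round t)
    have hW : otherWeight Δ κ α t (round t) ^ 2 ≤ ε * U := by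
      refine (tsum_sq_le_weightEnvelope hΔ hΔ1 hκ hρ (fun k => ?_) (fun k => ?_)
        (fun k hk => ?_)).trans (mul_le_mul_of_nonneg_right hexp hU0)
      · split_ifs
        · exact le_rfl
        · exact (peakWeight_pos _ _ _ _ k).le
      · split_ifs
        · exact (peakWeight_pos _ _ _ _ k).le
        · exact le_rfl
      · have : round t = k := round_eq_of_abs_sub_lt (hk.trans_le hρ2)
        simp [this]
    have he : ε ^ 2 * peakWeight Δ κ α t (round t) ^ 2 ≤ ε * U := by
      calc _ ≤ ε ^ 2 * U := mul_le_mul_of_nonneg_left hw (by positivity)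
        _ ≤ ε * U := mul_le_mul_of_nonneg_right (by nlinarith) hU0
    calc _ ≤ 2000 * (X * (ε * U + ε * U)) := by gcongr
      _ = _ := by ring
  · have hI0 : 0 ≤ ∫ x, ‖rawOutput a₀ a₁ Δ κ α u xm x‖ ^ 2 :=
      integral_nonneg fun x => by positivity
    have hF := fidelity_nonneg (qSEOutput Δ κ (fun x => qubit a₀ a₁ Δ κ α (x - u)) xm)
      (fun x => qubit a₀ a₁ (Δ / √2) (κ * √2)
        (α / 2 - step (xm - α * √(Real.pi / 2))) (x - u / 2))
    change 0 ≤ qSEFidelity a₀ a₁ Δ κ α u xm at hF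
    have hr := (rawOutput_bound hε0 (by linarith) h h0 h1 (sqrt_pi_mul_scaledResult α u xm)).2.2
    have hW : (∑' k, peakWeight Δ κ α t k) ^ 2 ≤ ε * U :=
      (tsum_sq_le_weightEnvelope hΔ hΔ1 hκ hρ (fun k => (peakWeight_pos _ _ _ _ k).le)
        (fun k => le_rfl) fun k hk => absurd ((round_le t k).trans_lt hk) hg).trans
        (mul_le_mul_of_nonneg_right hexp hU0)
    calc _ ≤ 1 * ∫ x, ‖rawOutput a₀ a₁ Δ κ α u xm x‖ ^ 2 :=
          mul_le_mul_of_nonneg_right (by linarith) hI0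
      _ ≤ 200 * (X * (∑' k, peakWeight Δ κ α t k) ^ 2) := by rw [one_mul]; exact hr
      _ ≤ 200 * (X * (ε * U)) := by gcongr
      _ ≤ _ := by
        have : 0 ≤ X * (ε * U) := by positivity
        linarith

lemma qSEFidelity_le_one (hε0 : 0 ≤ ε) (hε : ε ≤ 1 / 2) (h : SmallTails ε Δ κ) (α u xm : ℝ) :
    qSEFidelity a₀ a₁ Δ κ α u xm ≤ 1 := by
  have hΔ := h.1
  have hκ := h.2.1
  refine fidelity_le_one ?_
    (memLp_qubit_comp_sub a₀ a₁ (by positivity) (by positivity) _ (u / 2))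
  unfold qSEOutput
  simp_rw [qSE_eq]
  exact ((memLp_rawOutput hε0 hε h a₀ a₁ α u xm).const_mul _).const_mul _

lemma continuous_rawOutput (a₀ a₁ : ℂ) (Δ : ℝ) (hκ : 0 < κ) (α u : ℝ) :
    Continuous fun p : ℝ × ℝ => rawOutput a₀ a₁ Δ κ α u p.1 p.2 := by
  unfold rawOutput
  exact ((continuous_qubit a₀ a₁ Δ hκ α).comp (by fun_prop)).mul
    ((continuous_qubit 1 1 Δ hκ 0).comp (by fun_prop))

/-- The prediction jumps with the result but depends on it only through an integer, so it is
continuous in position on each of countably many pieces. -/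
lemma measurable_prediction (a₀ a₁ : ℂ) (Δ : ℝ) (hκ : 0 < κ) (α u : ℝ) :
    Measurable fun p : ℝ × ℝ =>
      qubit a₀ a₁ Δ κ (α / 2 - step (p.1 - α * √(Real.pi / 2))) (p.2 - u / 2) := by
  have h1 : Measurable fun q : ℤ × ℝ =>
      qubit a₀ a₁ Δ κ (α / 2 - ((q.1 % 4 : ℤ) : ℝ) / 2) (q.2 - u / 2) :=
    measurable_from_prod_countable_right fun n =>
      (continuous_qubit a₀ a₁ Δ hκ (α / 2 - ((n % 4 : ℤ) : ℝ) / 2)).measurable.comp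
        (measurable_id.sub_const (u / 2))
  have h2 : Measurable fun p : ℝ × ℝ =>
      (round ((p.1 - α * √(Real.pi / 2)) / √(Real.pi / 2)), p.2) := by
    refine Measurable.prodMk ?_ measurable_snd
    simp_rw [round_eq]
    exact Int.measurable_floor.comp (by fun_prop)
  have h3 := h1.comp h2
  simp only [Function.comp_def] at h3
  simpa only [step] using h3

/-- Needed for the integrability of density times fidelity: a non-integrable function would have
integral 0 and the lower bound would fail. -/
lemma measurable_qSEFidelity (a₀ a₁ : ℂ) (Δ : ℝ) (hκ : 0 < κ) (α u : ℝ) :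
    Measurable fun xm => qSEFidelity a₀ a₁ Δ κ α u xm := by
  have hr := (continuous_rawOutput a₀ a₁ Δ hκ α u).measurable
  have hI : Measurable fun xm => ∫ x, ‖rawOutput a₀ a₁ Δ κ α u xm x‖ ^ 2 :=
    (StronglyMeasurable.integral_prod_right'
      (f := fun p : ℝ × ℝ => ‖rawOutput a₀ a₁ Δ κ α u p.1 p.2‖ ^ 2)
      (hr.norm.pow_const 2).stronglyMeasurable).measurable
  have ho : Measurable fun p : ℝ × ℝ =>
      qSEOutput Δ κ (fun x => qubit a₀ a₁ Δ κ α (x - u)) p.1 p.2 := by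
    unfold qSEOutput
    simp_rw [integral_norm_sq_qSE, qSE_eq]
    refine Measurable.mul ?_ (hr.const_mul _)
    exact Complex.measurable_ofReal.comp
      ((hI.comp measurable_fst).const_mul _).sqrt.inv
  have hg := measurable_prediction a₀ a₁ (Δ / √2) (show 0 < κ * √2 by positivity) α u
  unfold qSEFidelity fidelity
  refine Measurable.div (Measurable.pow_const (Measurable.norm ?_) 2) (Measurable.mul ?_ ?_)
  · exact (StronglyMeasurable.integral_prod_right' (f := fun p : ℝ × ℝ =>
      (starRingEnd ℂ) (qSEOutput Δ κ (fun x => qubit a₀ a₁ Δ κ α (x - u)) p.1 p.2) *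
      qubit a₀ a₁ (Δ / √2) (κ * √2) (α / 2 - step (p.1 - α * √(Real.pi / 2))) (p.2 - u / 2))
      ((Complex.continuous_conj.measurable.comp ho).mul hg).stronglyMeasurable).measurable
  · exact (StronglyMeasurable.integral_prod_right' (f := fun p : ℝ × ℝ =>
      ‖qSEOutput Δ κ (fun x => qubit a₀ a₁ Δ κ α (x - u)) p.1 p.2‖ ^ 2)
      (ho.norm.pow_const 2).stronglyMeasurable).measurable
  · exact (StronglyMeasurable.integral_prod_right' (f := fun p : ℝ × ℝ =>
      ‖qubit a₀ a₁ (Δ / √2) (κ * √2) (α / 2 - step (p.1 - α * √(Real.pi / 2)))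
        (p.2 - u / 2)‖ ^ 2) (hg.norm.pow_const 2).stronglyMeasurable).measurable

end

/-! ### The average fidelity. -/

theorem average_fidelity (ε : ℝ) (hε : 0 < ε) (r : ℝ) (hr : r < √Real.pi / 2) :
    ∃ η : ℝ, 0 < η ∧ ∀ Δ κ : ℝ, 0 < Δ → Δ < η → 0 < κ → κ < η →
      ∀ a₀ a₁ : ℂ, (a₀ ≠ 0 ∨ a₁ ≠ 0) → ∀ α u : ℝ, |u| ≤ r →
        1 - ε ≤ ∫ xm : ℝ,
          GKP.outcomeDensity Δ κ (fun x => GKP.qubit a₀ a₁ Δ κ α (x - u)) xm *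
            GKP.qSEFidelity a₀ a₁ Δ κ α u xm := by
  set e := min ε 1 / 1000000 with he
  have he0 : 0 < e := by positivity
  have he1 : e ≤ 1 / 1000000 := by
    rw [he]; gcongr; exact min_le_right _ _
  have heε : 1000000 * e ≤ ε := by
    rw [he]; linarith [min_le_left ε 1]
  obtain ⟨η₁, h₁, H₁⟩ := exists_smallTails_pair he0
  have hM : 0 < 1 + gaussTail Real.pi := by linarith [gaussTail_nonneg Real.pi]
  have hρ : 0 < 1 / 2 - r / √Real.pi := by
    rw [sub_pos, div_lt_iff₀ (by positivity)]
    linarith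
  obtain ⟨η₂, h₂, H₂⟩ := exists_gaussTail_div_sq_le
    (c := Real.pi * (1 / 2 - r / √Real.pi) ^ 2 / 4) (by positivity)
    (show 0 < e / (1 + gaussTail Real.pi) by positivity)
  refine ⟨min (min η₁ η₂) (1 / 3), by positivity,
    fun Δ κ hΔ hΔη hκ hκη a₀ a₁ ha α u hu => ?_⟩
  simp only [lt_min_iff] at hΔη hκη
  obtain ⟨h, h'⟩ := H₁ Δ κ hΔ hΔη.1.1 hκ hκη.1.1
  have hexp : Real.exp (-(Real.pi * (1 / 2 - r / √Real.pi) ^ 2 / 4 / Δ ^ 2)) *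
      (1 + gaussTail Real.pi) ≤ e := by
    rw [← le_div_iff₀ hM]
    exact (exp_neg_le_gaussTail (by positivity)).trans (H₂ Δ hΔ hΔη.1.2)
  obtain ⟨A, hA0, hA, -, -⟩ := exists_amplitude a₀ a₁
  have hApos : 0 < A ^ 2 := by
    rw [hA]
    rcases ha with ha | ha
    · have := norm_pos_iff.2 ha; positivity
    · have := norm_pos_iff.2 ha; positivity
  obtain ⟨hIi, hT⟩ := integral_rawOutput_ge (a₀ := a₀) (a₁ := a₁) he0.le (by linarith) h hA α u
  have hpt := one_sub_qSEFidelity_mul_le_weightEnvelope (a₀ := a₀) (a₁ := a₁) he0.le (by linarith)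
    h h' hΔη.2.le hA hA0 hu hr hexp α
  obtain ⟨hUi, hUb⟩ := integrable_weightEnvelope_scaledResult h (by linarith) α u
  have hN := circuitNorm_pos he0.le (by linarith) h
  set I : ℝ → ℝ := fun y => ∫ x, ‖rawOutput a₀ a₁ Δ κ α u y x‖ ^ 2 with hI
  set T := ∫ y, I y with hTd
  have hT0 : 0 < T := lt_of_lt_of_le (by positivity) hT
  have hdens : ∀ xm, outcomeDensity Δ κ (fun x => qubit a₀ a₁ Δ κ α (x - u)) xm = I xm / T := by
    intro xm
    unfold outcomeDensity
    simp_rw [integral_norm_sq_qSE]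
    rw [integral_const_mul, mul_div_mul_left _ _ (by positivity)]
  simp_rw [hdens]
  set F : ℝ → ℝ := fun xm => qSEFidelity a₀ a₁ Δ κ α u xm with hF
  have hF0 : ∀ xm, 0 ≤ F xm := fun xm => fidelity_nonneg _ _
  have hF1 : ∀ xm, F xm ≤ 1 := qSEFidelity_le_one he0.le (by linarith) h α u
  have hI0 : ∀ xm, 0 ≤ I xm := fun xm => integral_nonneg fun x => by positivity
  have hdi : Integrable fun xm => I xm / T := hIi.div_const T
  have hFi : Integrable fun xm => I xm / T * F xm := by
    refine hdi.mono' (hdi.1.mul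
      (measurable_qSEFidelity a₀ a₁ Δ hκ α u).aestronglyMeasurable) (ae_of_all _ fun xm => ?_)
    have : 0 ≤ I xm / T := div_nonneg (hI0 xm) hT0.le
    rw [Real.norm_of_nonneg (mul_nonneg this (hF0 xm))]
    exact mul_le_of_le_one_right this (hF1 xm)
  -- The mixture has integral at most $15\Delta/\kappa$ and $T\ge A^2/3$, so the total loss is at
  -- most $4000\cdot15\cdot3\,e=180000\,e\le\varepsilon$.
  set c := 4000 * e * (A ^ 2 * (κ / Δ)) / T with hc
  have hbi : Integrable fun xm => I xm / T - c * weightEnvelope Δ κ α (scaledResult α u xm) :=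
    hdi.sub (hUi.const_mul c)
  calc 1 - ε ≤ 1 - c * (15 * Δ / κ) := by
        have : c * (15 * Δ / κ) = 60000 * e * A ^ 2 / T := by
          rw [hc]
          field_simp
          ring
        rw [this]
        have : 60000 * e * A ^ 2 / T ≤ 180000 * e := by
          rw [div_le_iff₀ hT0]
          have := mul_le_mul_of_nonneg_left hT (show 0 ≤ 180000 * e by positivity)
          linarith
        linarith
    _ ≤ 1 - c * ∫ xm, weightEnvelope Δ κ α (scaledResult α u xm) := by
        have hc0 : 0 ≤ c := by positivity
        linarith [mul_le_mul_of_nonneg_left hUb hc0]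
    _ = ∫ xm, (I xm / T - c * weightEnvelope Δ κ α (scaledResult α u xm)) := by
        rw [integral_sub hdi (hUi.const_mul c), integral_const_mul, integral_div,
          div_self hT0.ne']
    _ ≤ ∫ xm, I xm / T * F xm := by
        refine integral_mono hbi hFi fun xm => ?_
        have := div_le_div_of_nonneg_right (hpt xm) hT0.le
        have e1 : 4000 * e * (A ^ 2 * (κ / Δ)) * weightEnvelope Δ κ α (scaledResult α u xm) / T =
          c * weightEnvelope Δ κ α (scaledResult α u xm) := by rw [hc]; ring
        have e2 : (1 - F xm) * I xm / T = I xm / T - I xm / T * F xm := by ring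
        rw [e1] at this
        change (1 - F xm) * I xm / T ≤ _ at this
        rw [e2] at this
        simp only
        linarith

end GKP

theorem theorem1 :
    (∀ ε : ℝ, 0 < ε → ∀ δ : ℝ, 0 < δ → ∀ R : ℝ, 0 < R → ∃ η : ℝ, 0 < η ∧
      ∀ Δ κ : ℝ, 0 < Δ → Δ < η → 0 < κ → κ < η →
      ∀ a₀ a₁ : ℂ, (a₀ ≠ 0 ∨ a₁ ≠ 0) → ∀ α u xm : ℝ,
        |(xm - α * √(Real.pi / 2) - u / √2) / √(Real.pi / 2)
            - round ((xm - α * √(Real.pi / 2) - u / √2) / √(Real.pi / 2))| ≤ 1 / 2 - δ →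
        |xm - u / √2| ≤ R / κ →
        GKP.step (xm - α * √(Real.pi / 2) - u / √2) = GKP.step (xm - α * √(Real.pi / 2)) →
        1 - ε ≤ GKP.qSEFidelity a₀ a₁ Δ κ α u xm) ∧
    (∀ ε : ℝ, 0 < ε → ∀ r : ℝ, r < √Real.pi / 2 → ∃ η : ℝ, 0 < η ∧
      ∀ Δ κ : ℝ, 0 < Δ → Δ < η → 0 < κ → κ < η →
      ∀ a₀ a₁ : ℂ, (a₀ ≠ 0 ∨ a₁ ≠ 0) → ∀ α u : ℝ, |u| ≤ r →
        1 - ε ≤ ∫ xm : ℝ,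
          GKP.outcomeDensity Δ κ (fun x => GKP.qubit a₀ a₁ Δ κ α (x - u)) xm *
            GKP.qSEFidelity a₀ a₁ Δ κ α u xm) :=
  ⟨fun ε hε δ hδ R _ => GKP.fidelity_of_no_error ε hε δ hδ R,
    fun ε hε r hr => GKP.average_fidelity ε hε r hr⟩
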